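/- Let $G\neq 1$ be a group with a Garside structure $(G,P,\Delta)$ of finite type: $P\subseteq G$ is a submonoid with $P\cap P^{-1}=\{1\}$, $\Delta\in P$, $\Delta^{-1}P\Delta=P$; the order $a\preccurlyeq b\Leftrightarrow a^{-1}b\in P$ is a lattice order, with gcd $\wedge$; the set $[1,\Delta]=\{s: 1\preccurlyeq s\preccurlyeq\Delta\}$ of simple elements is finite and generates $G$; and for every $x\in P\setminus\{1\}$ the maximal number $\|x\|$ of factors in an expression of $x$ as a product of elements of $P\setminus\{1\}$ is finite. An atom is an element of $P\setminus\{1\}$ that is not a product of two elements of $P\setminus\{1\}$; let $a_1,\dots,a_\lambda$ be the distinct atoms. For $x\in G$ let $\inf(x)$ and $\sup(x)$ be the maximal and the minimal integer with $\Delta^{\inf(x)}\preccurlyeq x\preccurlyeq\Delta^{\sup(x)}$, let $$\mathfrak p(x)=x\Delta^{-\inf(x)}\wedge x^{-1}\Delta^{\sup(x)}\wedge\Delta,\qquad \mathfrak s(x)=\mathfrak p(x)^{-1}\,x\,\mathfrak p(x),$$ and let $\mathrm{SC}(x)$ be the set of all conjugates $y$ of $x$ with $\mathfrak s^m(y)=y$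 for some $m\ge 1$. Algorithm 1, with input $x$: (1) set $\widetilde x=x$, $c=1$, $\mathcal T=\emptyset$. (2) While $\widetilde x\notin\mathcal T$, set $\mathcal T=\mathcal T\cup\{\widetilde x\}$, $c=c\,\mathfrak p(\widetilde x)$, $\widetilde x=\mathfrak s(\widetilde x)$. (3) Set $y=\mathfrak s(\widetilde x)$, $d=\mathfrak p(\widetilde x)$. (4) While $y\ne\widetilde x$, set $d=d\,\mathfrak p(y)$, $y=\mathfrak s(y)$. (5) Return $\widetilde x$ and $c\,d^{-1}$. Cost model. Simple elements are accessible only through $\Delta$ and the following basic operation, which costs $C\ge 1$ units: given an atom $a$ and a simple element $s$, decide whether $a\preccurlyeq s$ (respectively $sa^{-1}\in P$) and, if so, return $a^{-1}s$ (respectively $sa^{-1}$). Every other elementary step (on integers, indices of atoms, list cells and tree nodes) costs $O(1)$. Input elements and the conjugating elements are stored as words in simple elements and their inverses, and multiplied by concatenation; the elements $\widetilde x$, $y$ are stored by their left normal forms $\Delta^px_1\cdots x_r$ (where $x_i\in[1,\Delta]\setminus\{1,\Delta\}$ and $x_i^{-1}\Delta\wedge x_{i+1}=1$), which are computed and updated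 by replacing pairs $s,t$ of adjacent factors by $su,\,u^{-1}t$ with $u=s^{-1}\Delta\wedge t$. For a normal form with $r>0$ the element $\mathfrak p$ is computed as $\Delta^px_1\Delta^{-p}\wedge x_r^{-1}\Delta$, and it is $1$ if $r=0$. Complements $s^{-1}\Delta$, $\Delta s^{-1}$, gcds and equality of simple elements are computed by splitting off atoms one at a time with the basic operation. $\mathcal T$ is stored as a digital search tree, in which a normal form is spelled by its exponent $p$ and by expressions of its factors as products of atoms. Proposition. For every $x\in G$, given as a word in simple elements and inverses of simple elements, Algorithm 1 terminates and returns an element $\widetilde x\in\mathrm{SC}(x)$, namely $\widetilde x=\mathfrak s^i(x)$ where $\mathfrak s^i(x)=\mathfrak s^j(x)$, $i<j$, is the first repetition in $x,\mathfrak s(x),\mathfrak s^2(x),\dots$, together with a word for an element $c\in G$ such that $c^{-1}xc=\widetilde x$. Moreover, if the word for $x$ has at most $k$ factors, where $k\ge1$, and if $T$ is an integer such that $\mathfrak s^i(x)=\mathfrak s^j(x)$ for some $0\le i<j\le T$, then the cost of Algorithm 1 is at most $$K\cdot C\,\lambda\,k\,(k+T)\,\|\Delta\|,$$ where $K$ is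 an absolute constant (independent of $G$, $P$, $\Delta$, $C$, $x$, $k$ and $T$). That is, the cost is $O(C\lambda k(k+T)\|\Delta\|)$. -/

import Mathlib

namespace Garside

/-! ### Garside groups -/

/-- A Garside structure `(G, P, Δ)` on a group `G`. -/
structure GarsideStructure (G : Type*) [Group G] where
  /-- the monoid of positive elements -/
  P : Submonoid G
  /-- the Garside element -/
  delta : G
  delta_mem : delta ∈ P
  eq_one_of_mem_of_inv_mem : ∀ x, x ∈ P → x⁻¹ ∈ P → x = 1
  /-- any two elements have a greatest common divisor for `a ≼ b ↔ a⁻¹ * b ∈ P` -/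
  exists_gcd : ∀ a b : G, ∃ d : G, (d⁻¹ * a ∈ P ∧ d⁻¹ * b ∈ P) ∧
    ∀ e : G, e⁻¹ * a ∈ P → e⁻¹ * b ∈ P → e⁻¹ * d ∈ P
  /-- any two elements have a least common multiple for `a ≼ b ↔ a⁻¹ * b ∈ P` -/
  exists_lcm : ∀ a b : G, ∃ m : G, (a⁻¹ * m ∈ P ∧ b⁻¹ * m ∈ P) ∧
    ∀ e : G, a⁻¹ * e ∈ P → b⁻¹ * e ∈ P → m⁻¹ * e ∈ P
  /-- the simple elements generate `G` -/
  closure_simple : Subgroup.closure {s : G | s ∈ P ∧ s⁻¹ * delta ∈ P} = ⊤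
  /-- `Δ⁻¹ P Δ = P` -/
  conj_delta_mem_iff : ∀ x : G, delta⁻¹ * x * delta ∈ P ↔ x ∈ P
  /-- the lengths of the factorizations of a positive element are bounded -/
  bddAbove_length : ∀ x ∈ P, x ≠ 1 →
    BddAbove {k : ℕ | ∃ l : List G, l.length = k ∧ (∀ a ∈ l, a ∈ P ∧ a ≠ 1) ∧ l.prod = x}

namespace GarsideStructure

variable {G : Type*} [Group G] (g : GarsideStructure G)

/-- The prefix order `a ≼ b`. -/
def Le (a b : G) : Prop := a⁻¹ * b ∈ g.P

/-- The suffix order: `Ge a b` means `a ≽ b`. -/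
def Ge (a b : G) : Prop := a * b⁻¹ ∈ g.P

/-- Simple elements: `1 ≼ s ≼ Δ`. -/
def IsSimple (s : G) : Prop := g.Le 1 s ∧ g.Le s g.delta

/-- The Garside structure is of finite type. -/
def FiniteType : Prop := {s : G | g.IsSimple s}.Finite

/-- Atoms: nontrivial positive elements that cannot be decomposed in `P`. -/
def IsAtom (a : G) : Prop :=
  a ∈ g.P ∧ a ≠ 1 ∧ ∀ b ∈ g.P, ∀ c ∈ g.P, a = b * c → b = 1 ∨ c = 1

/-- `‖x‖`, the maximal number of factors of `x` as a product of elements of `P \ {1}`. -/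
noncomputable def norm (x : G) : ℕ :=
  sSup {k : ℕ | ∃ l : List G, l.length = k ∧ (∀ a ∈ l, a ∈ g.P ∧ a ≠ 1) ∧ l.prod = x}

/-- The greatest common divisor `a ∧ b` for the prefix order. -/
noncomputable def gcd (a b : G) : G := (g.exists_gcd a b).choose

/-- `inf x`, the maximal integer `p` with `Δ ^ p ≼ x`. -/
noncomputable def inf (x : G) : ℤ := sSup {p : ℤ | g.Le (g.delta ^ p) x}

/-- `sup x`, the minimal integer `p` with `x ≼ Δ ^ p`. -/
noncomputable def sup (x : G) : ℤ := sInf {p : ℤ | g.Le x (g.delta ^ p)}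

/-- The preferred prefix `𝔭(x) = xΔ^{-inf x} ∧ x⁻¹Δ^{sup x} ∧ Δ`. -/
noncomputable def prefPrefix (x : G) : G :=
  g.gcd (g.gcd (x * g.delta ^ (-g.inf x)) (x⁻¹ * g.delta ^ g.sup x)) g.delta

/-- The cyclic sliding `𝔰(x) = 𝔭(x)⁻¹ x 𝔭(x)`. -/
noncomputable def slide (x : G) : G := (g.prefPrefix x)⁻¹ * x * g.prefPrefix x

/-- The set of sliding circuits `SC(x)`: the conjugates of `x` that are fixed by some positive
power of cyclic sliding. -/
def SC (x : G) : Set G := {y | IsConj x y ∧ ∃ m : ℕ, 1 ≤ m ∧ g.slide^[m] y = y}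

end GarsideStructure

/-! ### The cost model

A procedure is a partial computation with a clock. Every call of a procedure and every pass through
the body of a loop costs one unit, every basic operation costs `C` units, and apart from calls of
other procedures each such body performs a bounded number of elementary steps (pattern matching on or construction of one list
cell or tree node, one arithmetic operation on or comparison of integers or indices of atoms).
Simple elements are opaque: the procedures are polymorphic in the type `S` of their
representations, without an equality test, and can handle them only through the basic
operations. -/

/-- Computations that may fail to terminate, with a clock. -/
abbrev Timed (α : Type) : Type := StateT ℕ Part α

/-- Advance the clock by `n`. -/
def tick (n : ℕ) : Timed Unit := modify (· + n)

/-- The computation that never returns. -/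
def stuck {α : Type} : Timed α := fun _ => Part.none

/-- Run `body` again and again, on the state it has returned, until it returns a result. -/
def loop {σ α : Type} (body : σ → Timed (α ⊕ σ)) (s : σ) : Timed α := fun t =>
  PFun.fix (fun q : σ × ℕ => (body q.1 q.2).map fun r =>
    match r.1 with
    | .inl a => .inl (a, r.2)
    | .inr s' => .inr (s', r.2)) (s, t)

/-- What is known about simple elements, represented by data of type `S`; the atoms are indexed
by `Fin lam`. -/
structure BasicOps (S : Type) (lam : ℕ) where
  /-- the Garside element -/
  delta : S
  /-- given `a` and `s`, decide whether `a ≼ s` and, if so, compute `a⁻¹ s` -/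
  leftDiv : Fin lam → S → Option S
  /-- given `a` and `s`, decide whether `s ≽ a` and, if so, compute `s a⁻¹` -/
  rightDiv : Fin lam → S → Option S
  /-- the cost `C` of one basic operation -/
  cost : ℕ

/-- The basic operations do what they should: `val s` is the simple element represented by `s`,
and `atom i` is the atom with index `i`. -/
structure BasicOps.Realizes {S : Type} {lam : ℕ} (O : BasicOps S lam) {G : Type*} [Group G]
    (g : GarsideStructure G) (atom : Fin lam → G) (val : S → G) : Prop where
  isSimple : ∀ s, g.IsSimple (val s)
  delta : val O.delta = g.delta
  leftDiv_some : ∀ i s s', O.leftDiv i s = some s' →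
    g.Le (atom i) (val s) ∧ val s' = (atom i)⁻¹ * val s
  leftDiv_none : ∀ i s, O.leftDiv i s = none → ¬ g.Le (atom i) (val s)
  rightDiv_some : ∀ i s s', O.rightDiv i s = some s' →
    g.Ge (val s) (atom i) ∧ val s' = val s * (atom i)⁻¹
  rightDiv_none : ∀ i s, O.rightDiv i s = none → ¬ g.Ge (val s) (atom i)

/-- A simple element or the inverse of a simple element. -/
inductive Letter (S : Type) where
  | pos (s : S) : Letter S
  | neg (s : S) : Letter S

/-- The value of a letter in the group. -/
def Letter.toGroup {S : Type} {G : Type*} [Group G] (val : S → G) : Letter S → G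
  | .pos s => val s
  | .neg s => (val s)⁻¹

/-- The value in the group of a product of simple elements and inverses of simple elements. -/
def wordVal {S : Type} {G : Type*} [Group G] (val : S → G) (w : List (Letter S)) : G :=
  (w.map (Letter.toGroup val)).prod

/-- The data `(p, [x₁, …, xᵣ])` of a left normal form `Δ^p x₁ ⋯ xᵣ`. -/
structure NF (S : Type) where
  pow : ℤ
  factors : List S

/-- The element `Δ^p x₁ ⋯ xᵣ`. -/
def NF.toGroup {S : Type} {G : Type*} [Group G] (g : GarsideStructure G) (val : S → G)
    (x : NF S) : G :=
  g.delta ^ x.pow * (x.factors.map val).prod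

/-! ### Sets of sequences, stored as digital search trees -/

/-- The symbols by which a normal form is spelled in the search tree. -/
inductive Sym (lam : ℕ) where
  | power (p : ℤ) : Sym lam
  | atom (i : Fin lam) : Sym lam
  | sep : Sym lam
  | final : Sym lam
  deriving DecidableEq

/-- A digital search tree, in first-child / next-sibling form. -/
inductive Tree (K : Type) where
  | empty : Tree K
  | node (key : K) (child sibling : Tree K) : Tree K

/-- Is the sequence spelled by a path of the tree? -/
def Tree.mem {K : Type} [DecidableEq K] : Tree K → List K → Timed Bool
  | _, [] => do
    tick 1
    return true
  | .empty, _ :: _ => do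
    tick 1
    return false
  | .node k' c s, k :: ks => do
    tick 1
    if k = k' then Tree.mem c ks else Tree.mem s (k :: ks)

/-- The tree with a single path. -/
def Tree.path {K : Type} : List K → Timed (Tree K)
  | [] => do
    tick 1
    return .empty
  | k :: ks => do
    tick 1
    return .node k (← Tree.path ks) .empty

/-- Add a path to a tree. -/
def Tree.insert {K : Type} [DecidableEq K] : Tree K → List K → Timed (Tree K)
  | t, [] => do
    tick 1
    return t
  | .empty, k :: ks => do
    tick 1
    Tree.path (k :: ks)
  | .node k' c s, k :: ks => do
    tick 1
    if k = k' then
      return .node k' (← Tree.insert c ks) s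
    else
      return .node k' c (← Tree.insert s (k :: ks))

/-! ### Operations on simple elements -/

section Programs

variable {S : Type} {lam : ℕ} (O : BasicOps S lam)

/-- The basic operation for `≼`, at cost `C`. -/
def tryLeft (i : Fin lam) (s : S) : Timed (Option S) := do
  tick O.cost
  return O.leftDiv i s

/-- The basic operation for `≽`, at cost `C`. -/
def tryRight (i : Fin lam) (s : S) : Timed (Option S) := do
  tick O.cost
  return O.rightDiv i s

/-- Take the first atom `a` of the list with `a ≼ s`, and compute `a⁻¹ s`. -/
def takeLeft (s : S) : List (Fin lam) → Timed (Option (Fin lam × S))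
  | [] => do
    tick 1
    return none
  | i :: l => do
    tick 1
    match ← tryLeft O i s with
    | some s' => return some (i, s')
    | none => takeLeft s l

/-- Take the first atom `a` of the list with `s ≽ a`, and compute `s a⁻¹`. -/
def takeRight (s : S) : List (Fin lam) → Timed (Option (Fin lam × S))
  | [] => do
    tick 1
    return none
  | i :: l => do
    tick 1
    match ← tryRight O i s with
    | some s' => return some (i, s')
    | none => takeRight s l

/-- Take the first atom `a` of the list with `a ≼ s` and `a ≼ t`, and compute `a⁻¹ s` and
`a⁻¹ t`. -/
def takeCommon (s t : S) : List (Fin lam) → Timed (Option (Fin lam × S × S))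
  | [] => do
    tick 1
    return none
  | i :: l => do
    tick 1
    match ← tryLeft O i s with
    | none => takeCommon s t l
    | some s' =>
      match ← tryLeft O i t with
      | none => takeCommon s t l
      | some t' => return some (i, s', t')

/-- Test whether `s = 1`. -/
def isOne (s : S) : Timed Bool := do
  tick 1
  match ← takeLeft O s (List.finRange lam) with
  | none => return true
  | some _ => return false

/-- While `s ≠ 1`, remove an atom from the left of `s` and of `d`. Returns `s⁻¹ d`. -/
def rightComplLoop (d s : S) : Timed S :=
  loop (fun (d, s) => do
    tick 1
    match ← takeLeft O s (List.finRange lam) with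
    | none => return .inl d
    | some (i, s') =>
      match ← tryLeft O i d with
      | none => stuck
      | some d' => return .inr (d', s')) (d, s)

/-- The right complement `∂(s) = s⁻¹ Δ`. -/
def rightCompl (s : S) : Timed S := do
  tick 1
  rightComplLoop O O.delta s

/-- While `s ≠ 1`, remove an atom from the right of `s` and of `d`. Returns `d s⁻¹`. -/
def leftComplLoop (d s : S) : Timed S :=
  loop (fun (d, s) => do
    tick 1
    match ← takeRight O s (List.finRange lam) with
    | none => return .inl d
    | some (i, s') =>
      match ← tryRight O i d with
      | none => stuck
      | some d' => return .inr (d', s')) (d, s)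

/-- The left complement `∂⁻¹(s) = Δ s⁻¹`. -/
def leftCompl (s : S) : Timed S := do
  tick 1
  leftComplLoop O O.delta s

/-- Test whether `s = Δ`. -/
def isDelta (s : S) : Timed Bool := do
  tick 1
  isOne O (← rightCompl O s)

/-- `τ(s) = Δ⁻¹ s Δ = ∂²(s)`. -/
def tau (s : S) : Timed S := do
  tick 1
  rightCompl O (← rightCompl O s)

/-- `τ⁻¹(s) = ∂⁻²(s)`. -/
def tauInv (s : S) : Timed S := do
  tick 1
  leftCompl O (← leftCompl O s)

/-- `τⁿ(s)` for a natural number `n`. -/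
def tauIter : ℕ → S → Timed S
  | 0, s => do
    tick 1
    return s
  | n + 1, s => do
    tick 1
    tauIter n (← tau O s)

/-- `τ⁻ⁿ(s)` for a natural number `n`. -/
def tauInvIter : ℕ → S → Timed S
  | 0, s => do
    tick 1
    return s
  | n + 1, s => do
    tick 1
    tauInvIter n (← tauInv O s)

/-- `τ^p(s)` for an integer `p`. -/
def tauPow (p : ℤ) (s : S) : Timed S := do
  tick 1
  if 0 ≤ p then tauIter O p.natAbs s else tauInvIter O p.natAbs s

/-- Remove from `s`, `t` and `d` the atoms of `s ∧ t`, one by one. Returns `(s ∧ t)⁻¹ d`. -/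
def gcdLoop (d s t : S) : Timed S :=
  loop (fun (d, s, t) => do
    tick 1
    match ← takeCommon O s t (List.finRange lam) with
    | none => return .inl d
    | some (i, s', t') =>
      match ← tryLeft O i d with
      | none => stuck
      | some d' => return .inr (d', s', t')) (d, s, t)

/-- The greatest common divisor `s ∧ t` of two simple elements. -/
def simpleGcd (s t : S) : Timed S := do
  tick 1
  leftCompl O (← gcdLoop O O.delta s t)

/-- Remove from `s` and `t` the atoms of `s ∧ t`, one by one.
Returns `(s ∧ t)⁻¹ s` and `(s ∧ t)⁻¹ t`. -/
def stripCommon (s t : S) : Timed (S × S) :=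
  loop (fun (s, t) => do
    tick 1
    match ← takeCommon O s t (List.finRange lam) with
    | none => return .inl (s, t)
    | some (_, s', t') => return .inr (s', t')) (s, t)

/-- Test whether `s = t`. -/
def simpleEq (s t : S) : Timed Bool := do
  tick 1
  let (s', t') ← stripCommon O s t
  if ← isOne O s' then isOne O t' else return false

/-- The local sliding of the pair `s, t`: the pair `s u, u⁻¹ t` with `u = ∂(s) ∧ t`. -/
def localSliding (s t : S) : Timed (S × S) := do
  tick 1
  let (s', t') ← stripCommon O (← rightCompl O s) t
  return (← leftCompl O s', t')

/-! ### Left normal forms -/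

/-- Bring `s₁ ⋯ sₖ s` into left weighted form by local slidings from right to left, where
`s₁ ⋯ sₖ` is left weighted. Returns the first factor and the list of the other factors. -/
def insertRight : List S → S → Timed (S × List S)
  | [], s => do
    tick 1
    return (s, [])
  | x :: l, s => do
    tick 1
    let (y, ys) ← insertRight l s
    let (x', y') ← localSliding O x y
    return (x', y' :: ys)

/-- Bring `s s₁ ⋯ sₖ` into left weighted form by local slidings from left to right, where
`s₁ ⋯ sₖ` is left weighted. Returns the first factor and the list of the other factors. -/
def insertLeft : S → List S → Timed (S × List S)
  | s, [] => do
    tick 1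
    return (s, [])
  | s, x :: l => do
    tick 1
    let (s', x') ← localSliding O s x
    let (y, ys) ← insertLeft x' l
    return (s', y :: ys)

/-- Remove the last factor if it is trivial. -/
def dropLastOne : List S → Timed (List S)
  | [] => do
    tick 1
    return []
  | x :: l => do
    tick 1
    match l with
    | [] => if ← isOne O x then return [] else return [x]
    | y :: l' => return x :: (← dropLastOne (y :: l'))

/-- The left normal form of `Δ^p y y₁ ⋯ yᵣ`, where `y y₁ ⋯ yᵣ` is left weighted, `y` may be `Δ`
and the last factor may be `1`. -/
def cleanUp (p : ℤ) (y : S) (ys : List S) : Timed (NF S) := do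
  tick 1
  if ← isDelta O y then
    return ⟨p + 1, ← dropLastOne O ys⟩
  else
    return ⟨p, ← dropLastOne O (y :: ys)⟩

/-- Apply `τ⁻¹` to all factors. -/
def tauInvAll : List S → Timed (List S)
  | [] => do
    tick 1
    return []
  | s :: l => do
    tick 1
    let s' ← tauInv O s
    return s' :: (← tauInvAll l)

/-- The left normal form of `x s`. -/
def mulRight (x : NF S) (s : S) : Timed (NF S) := do
  tick 1
  let (y, ys) ← insertRight O x.factors s
  cleanUp O x.pow y ys

/-- The left normal form of `x s⁻¹ = x Δ⁻¹ ∂⁻¹(s)`. -/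
def mulRightInv (x : NF S) (s : S) : Timed (NF S) := do
  tick 1
  let l ← tauInvAll O x.factors
  let (y, ys) ← insertRight O l (← leftCompl O s)
  cleanUp O (x.pow - 1) y ys

/-- The left normal form of `s⁻¹ x = Δ⁻¹ ∂⁻¹(s) x`. -/
def mulLeftInv (s : S) (x : NF S) : Timed (NF S) := do
  tick 1
  let s' ← tauPow O x.pow (← leftCompl O s)
  let (y, ys) ← insertLeft O s' x.factors
  cleanUp O (x.pow - 1) y ys

/-- The left normal form of `x w`. -/
def mulWord : NF S → List (Letter S) → Timed (NF S)
  | x, [] => do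
    tick 1
    return x
  | x, .pos s :: w => do
    tick 1
    mulWord (← mulRight O x s) w
  | x, .neg s :: w => do
    tick 1
    mulWord (← mulRightInv O x s) w

/-- The left normal form of a product of simple elements and inverses of simple elements. -/
def normalForm (w : List (Letter S)) : Timed (NF S) := do
  tick 1
  mulWord O ⟨0, []⟩ w

/-- Test whether two lists of simple elements agree. -/
def factorsEq : List S → List S → Timed Bool
  | [], [] => do
    tick 1
    return true
  | s :: l, t :: m => do
    tick 1
    if ← simpleEq O s t then factorsEq l m else return false
  | _, _ => do
    tick 1
    return false

/-- Test whether two elements given by their left normal forms are equal. -/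
def nfEq (x y : NF S) : Timed Bool := do
  tick 1
  if x.pow = y.pow then factorsEq O x.factors y.factors else return false

/-! ### Cyclic sliding -/

/-- The last element of the list `x :: l`. -/
def lastFactor : S → List S → Timed S
  | x, [] => do
    tick 1
    return x
  | _, y :: l => do
    tick 1
    lastFactor y l

/-- The preferred prefix `𝔭(x) = ι(x) ∧ ∂(φ(x))`, where `ι(x) = τ^{-p}(x₁)` and `φ(x) = xᵣ` if
`x = Δ^p x₁ ⋯ xᵣ` with `r > 0`, and `𝔭(x) = 1` if `r = 0`. -/
def prefixProg (x : NF S) : Timed S := do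
  tick 1
  match x.factors with
  | [] => rightCompl O O.delta
  | x₁ :: l =>
    let initial ← tauPow O (-x.pow) x₁
    let final ← lastFactor x₁ l
    simpleGcd O initial (← rightCompl O final)

/-- The left normal form of `s⁻¹ x s`. -/
def conjProg (x : NF S) (s : S) : Timed (NF S) := do
  tick 1
  mulRight O (← mulLeftInv O s x) s

/-! ### The set of visited elements -/

/-- Spell a simple element in front of `rest`: the symbols are the atoms of the lexicographically
first expression of `s` as a product of atoms, in reverse order, and a separator. -/
def spellSimple (rest : List (Sym lam)) (s : S) : Timed (List (Sym lam)) :=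
  loop (fun (r, s) => do
    tick 1
    match ← takeLeft O s (List.finRange lam) with
    | none => return .inl r
    | some (i, s') => return .inr (.atom i :: r, s')) (.sep :: rest, s)

/-- Spell a list of simple elements. -/
def spellFactors : List S → Timed (List (Sym lam))
  | [] => do
    tick 1
    return [.final]
  | s :: l => do
    tick 1
    spellSimple O (← spellFactors l) s

/-- Spell an element given by its left normal form. -/
def spell (x : NF S) : Timed (List (Sym lam)) := do
  tick 1
  return .power x.pow :: (← spellFactors O x.factors)

/-! ### The algorithm -/

/-- While `x ∉ 𝒯`, add `x` to `𝒯`, multiply `c` by `𝔭(x)` and replace `x` by `𝔰(x)`.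
The factors of `c` are stored in reverse order. -/
def trajectoryLoop (visited : Tree (Sym lam)) (c : List S) (x : NF S) :
    Timed (NF S × List S) :=
  loop (fun (visited, c, x) => do
    tick 1
    let key ← spell O x
    if ← visited.mem key then
      return .inl (x, c)
    else
      let visited' ← visited.insert key
      let s ← prefixProg O x
      let x' ← conjProg O x s
      return .inr (visited', s :: c, x')) (visited, c, x)

/-- While `y ≠ x`, multiply `d` by `𝔭(y)` and replace `y` by `𝔰(y)`.
The factors of `d` are stored in reverse order. -/
def circuitLoop (x : NF S) (d : List S) (y : NF S) : Timed (List S) :=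
  loop (fun (d, y) => do
    tick 1
    if ← nfEq O y x then
      return .inl d
    else
      let s ← prefixProg O y
      let y' ← conjProg O y s
      return .inr (s :: d, y')) (d, y)

/-- The word `d⁻¹`, where the factors of `d` are stored in reverse order. -/
def invWord : List S → Timed (List (Letter S))
  | [] => do
    tick 1
    return []
  | s :: l => do
    tick 1
    return .neg s :: (← invWord l)

/-- The word `c w`, where the factors of `c` are stored in reverse order. -/
def prependWord : List S → List (Letter S) → Timed (List (Letter S))
  | [], w => do
    tick 1
    return w
  | s :: l, w => do
    tick 1
    prependWord l (.pos s :: w)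

/-- Computing one element of `SC(x)`, and a conjugating element, from a product of simple
elements and inverses of simple elements that represents `x`. -/
def algorithm1 (w : List (Letter S)) : Timed (NF S × List (Letter S)) := do
  tick 1
  let x ← normalForm O w
  let (xt, c) ← trajectoryLoop O .empty [] x
  let s ← prefixProg O xt
  let y ← conjProg O xt s
  let d ← circuitLoop O xt [s] y
  return (xt, ← prependWord c (← invWord d))

end Programs

end Garside

namespace Garside

namespace GarsideStructure

variable {G : Type*} [Group G] {g : GarsideStructure G}

/-! ### The prefix order -/

/-! Put U = Cλ‖Δ‖. A simple element is consumed atom by atom. By superadditivity of the norm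
(`norm_add_norm_le`) this takes at most ‖Δ‖ rounds, and a round tries each of the λ atoms a bounded
number of times. Hence complements, gcds, equality tests and local slidings of simple elements cost
O(U).

Normal forms are governed by `le_of_isChain`: the head of a left weighted sequence absorbs every
simple prefix of the product. This gives uniqueness and reads off inf; its counterpart at the other
end, `getLast_mul_le`, gives sup. Together they identify 𝔭(x) with the gcd of the initial factor and
the complement of the final factor (`IsNormal.prefPrefix_eq`). Multiplying a normal form by a simple
element needs a single pass of local slidings (`InsRight.isAlmostNormal`, which rests on the domino
rule, and `InsLeft.isAlmostNormal`), at cost O(U) per factor.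

A word of k letters lies between Δ^{-k} and Δ^k, and sliding preserves such bounds
(`IsNormal.slide_bounds`). So each element of the trajectory has an exponent of absolute value at
most k and at most 2k factors. In finite type only finitely many elements are possible, which forces
a repetition; moreover each slide and each comparison costs O(kU). The keys of the visited elements
form a prefix-free code of length O(k‖Δ‖); below the root the tree branches at most λ + 2 times, so
a search or insertion costs O(kλ‖Δ‖), however many elements are stored (`tree_cost_le`). The initial
normal form costs O(k²U) and the two loops O(kU) per pass, hence O(k(k+T)U) in total.

The first loop stops exactly at the first index j that repeats an earlier i, and 𝔰^j(x) = 𝔰^i(x).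
The second loop runs once around the circuit, so d commutes with x̃ and c d⁻¹ conjugates x to x̃
just as c does. Values and costs are proved together, as statements `Spec`. -/

theorem le_refl (a : G) : g.Le a a := by simp [Le]

theorem Le.trans {a b c : G} (h₁ : g.Le a b) (h₂ : g.Le b c) : g.Le a c := by
  have := g.P.mul_mem h₁ h₂
  simpa [Le, mul_assoc] using this

theorem Le.antisymm {a b : G} (h₁ : g.Le a b) (h₂ : g.Le b a) : a = b := by
  have := g.eq_one_of_mem_of_inv_mem _ h₁ (by simpa [Le] using h₂)
  exact inv_mul_eq_one.1 this

theorem le_mul_right (a : G) {p : G} (hp : p ∈ g.P) : g.Le a (a * p) := by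
  simpa [Le] using hp

theorem mul_le_mul_left_iff {a b : G} (c : G) : g.Le (c * a) (c * b) ↔ g.Le a b := by
  simp [Le, mul_assoc]

theorem one_le_iff {x : G} : g.Le 1 x ↔ x ∈ g.P := by simp [Le]

theorem eq_one_of_le_one {x : G} (hx : x ∈ g.P) (h : g.Le x 1) : x = 1 :=
  h.antisymm (one_le_iff.2 hx)

theorem conj_delta_pow_mem_iff (n : ℕ) (x : G) :
    (g.delta ^ n)⁻¹ * x * g.delta ^ n ∈ g.P ↔ x ∈ g.P := by
  induction n generalizing x with
  | zero => simp
  | succ n ih =>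
    rw [← ih x, ← g.conj_delta_mem_iff ((g.delta ^ n)⁻¹ * x * g.delta ^ n)]
    simp [pow_succ, mul_assoc]

theorem conj_delta_zpow_mem_iff (n : ℤ) (x : G) :
    (g.delta ^ n)⁻¹ * x * g.delta ^ n ∈ g.P ↔ x ∈ g.P := by
  obtain ⟨n, rfl | rfl⟩ := n.eq_nat_or_neg
  · simpa using conj_delta_pow_mem_iff n x
  · rw [← conj_delta_pow_mem_iff n]
    simp [mul_assoc]

/-- The prefix order is invariant under left multiplication only; powers of Δ are harmless on the
right because conjugation by Δ preserves P. -/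
theorem mul_delta_zpow_le_iff (n : ℤ) {a b : G} :
    g.Le (a * g.delta ^ n) (b * g.delta ^ n) ↔ g.Le a b := by
  rw [Le, Le, ← conj_delta_zpow_mem_iff n (a⁻¹ * b)]
  simp [mul_assoc]

theorem mul_delta_le_iff {a b : G} : g.Le (a * g.delta) (b * g.delta) ↔ g.Le a b := by
  simpa using mul_delta_zpow_le_iff (g := g) 1 (a := a) (b := b)

theorem delta_zpow_le {m n : ℤ} (h : m ≤ n) : g.Le (g.delta ^ m) (g.delta ^ n) := by
  obtain ⟨k, rfl⟩ := Int.le.dest h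
  rw [Le, zpow_add, inv_mul_cancel_left, zpow_natCast]
  exact pow_mem g.delta_mem k

/-! ### Greatest common divisors -/

theorem gcd_le_left (a b : G) : g.Le (g.gcd a b) a := (g.exists_gcd a b).choose_spec.1.1

theorem gcd_le_right (a b : G) : g.Le (g.gcd a b) b := (g.exists_gcd a b).choose_spec.1.2

theorem le_gcd {a b e : G} (ha : g.Le e a) (hb : g.Le e b) : g.Le e (g.gcd a b) :=
  (g.exists_gcd a b).choose_spec.2 e ha hb

/-- A common prefix is the greatest one as soon as the quotients are coprime. -/
theorem gcd_mul_eq {u a b : G} (ha : a ∈ g.P) (hb : b ∈ g.P)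
    (h : ∀ e ∈ g.P, g.Le e a → g.Le e b → e = 1) : g.gcd (u * a) (u * b) = u := by
  have h₁ : g.Le u (g.gcd (u * a) (u * b)) := le_gcd (le_mul_right _ ha) (le_mul_right _ hb)
  have h₂ := h _ h₁ ((mul_le_mul_left_iff u).1 (by simpa using gcd_le_left (u * a) (u * b)))
    ((mul_le_mul_left_iff u).1 (by simpa using gcd_le_right (u * a) (u * b)))
  exact (inv_mul_eq_one.1 h₂).symm

/-! ### Simple elements -/

theorem IsSimple.mem {s : G} (h : g.IsSimple s) : s ∈ g.P := one_le_iff.1 h.1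

theorem IsSimple.rightCompl {s : G} (h : g.IsSimple s) : g.IsSimple (s⁻¹ * g.delta) := by
  refine ⟨one_le_iff.2 h.2, ?_⟩
  have := (g.conj_delta_mem_iff s).2 h.mem
  simpa [Le, mul_assoc] using this

theorem IsSimple.leftCompl {s : G} (h : g.IsSimple s) : g.IsSimple (g.delta * s⁻¹) := by
  refine ⟨one_le_iff.2 ?_, ?_⟩
  · rw [← g.conj_delta_mem_iff]
    simpa [Le, mul_assoc] using h.2
  · simpa [Le, mul_assoc] using h.mem

theorem IsSimple.conj_delta {s : G} (h : g.IsSimple s) (n : ℤ) :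
    g.IsSimple ((g.delta ^ n)⁻¹ * s * g.delta ^ n) := by
  refine ⟨one_le_iff.2 ((conj_delta_zpow_mem_iff n s).2 h.mem), ?_⟩
  have := (conj_delta_zpow_mem_iff n (s⁻¹ * g.delta)).2 h.2
  rw [Le]
  convert this using 1
  have : Commute g.delta (g.delta ^ n) := Commute.self_zpow _ _
  simp only [mul_inv_rev, inv_inv, mul_assoc, this.eq]

/-! ### Norm and atoms -/

theorem one_of_prod_eq_one {l : List G} (hl : ∀ a ∈ l, a ∈ g.P ∧ a ≠ 1) (h : l.prod = 1) :
    l = [] := by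
  cases l with
  | nil => rfl
  | cons a l =>
    exfalso
    rw [List.prod_cons] at h
    have h₁ : l.prod ∈ g.P := Submonoid.list_prod_mem _ fun b hb => (hl b (by simp [hb])).1
    have h₂ := hl a (by simp)
    refine h₂.2 (g.eq_one_of_mem_of_inv_mem a h₂.1 ?_)
    rwa [inv_eq_of_mul_eq_one_right h]

/-- The axiom omits x = 1, whose only factorization is the empty one. Thus the supremum in `norm` is
a maximum on all of P. -/
theorem bddAbove_lengths {x : G} (hx : x ∈ g.P) :
    BddAbove {k : ℕ | ∃ l : List G, l.length = k ∧ (∀ a ∈ l, a ∈ g.P ∧ a ≠ 1) ∧ l.prod = x} := by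
  by_cases h : x = 1
  · refine ⟨0, ?_⟩
    rintro k ⟨l, rfl, hl, hp⟩
    simp [one_of_prod_eq_one hl (hp.trans h)]
  · exact g.bddAbove_length x hx h

theorem length_le_norm {l : List G} (hl : ∀ a ∈ l, a ∈ g.P ∧ a ≠ 1) :
    l.length ≤ g.norm l.prod :=
  le_csSup (bddAbove_lengths (Submonoid.list_prod_mem _ fun a ha => (hl a ha).1)) ⟨l, rfl, hl, rfl⟩

theorem exists_length_eq_norm {x : G} (hx : x ∈ g.P) :
    ∃ l : List G, l.length = g.norm x ∧ (∀ a ∈ l, a ∈ g.P ∧ a ≠ 1) ∧ l.prod = x := by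
  refine Nat.sSup_mem (s := {k : ℕ | ∃ l : List G, l.length = k ∧
    (∀ a ∈ l, a ∈ g.P ∧ a ≠ 1) ∧ l.prod = x}) ?_ (bddAbove_lengths hx)
  by_cases h : x = 1
  · exact ⟨0, [], by simp [h]⟩
  · exact ⟨1, [x], by simp [h, hx]⟩

/-- Two longest factorizations can be concatenated. This makes the norm a termination measure for
splitting off atoms. -/
theorem norm_add_norm_le {a b : G} (ha : a ∈ g.P) (hb : b ∈ g.P) :
    g.norm a + g.norm b ≤ g.norm (a * b) := by
  obtain ⟨l, hl, hl', rfl⟩ := exists_length_eq_norm ha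
  obtain ⟨m, hm, hm', rfl⟩ := exists_length_eq_norm hb
  rw [← hl, ← hm, ← List.length_append, ← List.prod_append]
  refine length_le_norm fun c hc => ?_
  rcases List.mem_append.1 hc with h | h
  exacts [hl' c h, hm' c h]

theorem one_le_norm {x : G} (hx : x ∈ g.P) (h : x ≠ 1) : 1 ≤ g.norm x := by
  simpa using length_le_norm (g := g) (l := [x]) (by simp [hx, h])

theorem IsSimple.norm_le {s : G} (h : g.IsSimple s) : g.norm s ≤ g.norm g.delta := by
  have := norm_add_norm_le h.mem h.2
  rw [mul_inv_cancel_left] at this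
  omega

/-- If x = bc properly, then c contributes at least 1 to the norm, so b has smaller norm and
induction applies to b. -/
theorem exists_isAtom_le {x : G} (hx : x ∈ g.P) (h : x ≠ 1) : ∃ a, g.IsAtom a ∧ g.Le a x := by
  induction hn : g.norm x using Nat.strong_induction_on generalizing x with
  | _ n ih =>
    by_cases hA : g.IsAtom x
    · exact ⟨x, hA, le_refl x⟩
    · simp only [IsAtom, not_and, not_forall, not_or] at hA
      obtain ⟨b, hb, c, hc, rfl, hb', hc'⟩ := hA hx h
      have := norm_add_norm_le hb hc
      have := one_le_norm hc hc'
      obtain ⟨a, ha, hab⟩ := ih _ (by omega) hb hb' rfl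
      exact ⟨a, ha, hab.trans (le_mul_right b hc)⟩

theorem exists_isAtom_ge {x : G} (hx : x ∈ g.P) (h : x ≠ 1) : ∃ a, g.IsAtom a ∧ g.Ge x a := by
  induction hn : g.norm x using Nat.strong_induction_on generalizing x with
  | _ n ih =>
    by_cases hA : g.IsAtom x
    · exact ⟨x, hA, by simp [Ge]⟩
    · simp only [IsAtom, not_and, not_forall, not_or] at hA
      obtain ⟨b, hb, c, hc, rfl, hb', hc'⟩ := hA hx h
      have := norm_add_norm_le hb hc
      have := one_le_norm hb hb'
      obtain ⟨a, ha, hca⟩ := ih _ (by omega) hc hc' rfl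
      refine ⟨a, ha, ?_⟩
      have := g.P.mul_mem hb hca
      simpa [Ge, mul_assoc] using this

/-- If Δ = 1, then 1 is the only simple element and the simple elements generate the trivial group.
-/
theorem delta_ne_one [Nontrivial G] : g.delta ≠ 1 := by
  intro h
  have : {s : G | s ∈ g.P ∧ s⁻¹ * g.delta ∈ g.P} ⊆ {1} := by
    rintro s ⟨h₁, h₂⟩
    exact g.eq_one_of_mem_of_inv_mem s h₁ (by simpa [h] using h₂)
  have h₂ := Subgroup.closure_mono this
  rw [g.closure_simple, Subgroup.closure_singleton_one, top_le_iff] at h₂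
  exact bot_ne_top h₂

/-! ### Left weighted sequences -/

/-- The pair `s, t` is left weighted: `∂(s) ∧ t = 1`. -/
def LeftWeighted (g : GarsideStructure G) (s t : G) : Prop :=
  ∀ e ∈ g.P, g.Le e (s⁻¹ * g.delta) → g.Le e t → e = 1

/-- Let m be the lcm of e and s. Both divide Δ and the product, hence so does m, and s⁻¹m is a
simple prefix of the tail. By induction it divides the next factor t; as it also divides ∂(s), it is
1, so m = s. -/
theorem le_of_isChain {s : G} {l : List G} (hs : g.IsSimple s) (hl : ∀ t ∈ l, g.IsSimple t)
    (h : (s :: l).IsChain g.LeftWeighted) {e : G} (he : g.Le e g.delta)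
    (hle : g.Le e (s * l.prod)) : g.Le e s := by
  induction l generalizing s e with
  | nil => simpa using hle
  | cons t l ih =>
    obtain ⟨m, ⟨h₁, h₂⟩, h₃⟩ := g.exists_lcm e s
    have hm : g.Le m g.delta := h₃ _ he hs.2
    have hm' : g.Le m (s * (t :: l).prod) := h₃ _ hle
      (le_mul_right _ (Submonoid.list_prod_mem _ fun t ht => (hl t ht).mem))
    rw [List.isChain_cons_cons] at h
    have hu : g.Le (s⁻¹ * m) (s⁻¹ * g.delta) := (mul_le_mul_left_iff _).2 hm
    have hu' : g.Le (s⁻¹ * m) t := by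
      refine ih (hl t (by simp)) (fun t ht => hl t (by simp [ht])) h.2
        (hu.trans hs.rightCompl.2) ?_
      rw [← List.prod_cons, ← mul_le_mul_left_iff s]
      simpa using hm'
    have := h.1 _ h₂ hu hu'
    rw [inv_mul_eq_one] at this
    rw [this]
    exact h₁

/-- If e divides ∂(s) and the tail, then se is a simple prefix of the whole product, so the head
absorbs it. -/
theorem LeftWeighted.prod {s : G} {l : List G} (hs : g.IsSimple s) (hl : ∀ t ∈ l, g.IsSimple t)
    (h : (s :: l).IsChain g.LeftWeighted) : g.LeftWeighted s l.prod := by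
  intro e he h₁ h₂
  refine eq_one_of_le_one he ?_
  rw [← mul_le_mul_left_iff s, mul_one]
  refine le_of_isChain hs hl h ?_ ((mul_le_mul_left_iff s).2 h₂)
  rw [← mul_le_mul_left_iff s] at h₁
  simpa using h₁

/-- If `q` is coprime to the complement of `x`, and `x q w ≼ Δ^(n+1)` where `w ≼ Δ^n`, then
`q w ≼ Δ^n`. -/
theorem LeftWeighted.mul_le_delta_zpow {x q w : G} {n : ℤ} (h : g.LeftWeighted x q)
    (hx : g.IsSimple x) (hq : q ∈ g.P) (hw : g.Le w (g.delta ^ n))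
    (hle : g.Le (x * (q * w)) (g.delta ^ (n + 1))) : g.Le (q * w) (g.delta ^ n) := by
  -- Translated by q, this gcd becomes ∂(x) ∧ q, which is trivial by hypothesis.
  have h₁ : g.Le (g.gcd (q⁻¹ * (x⁻¹ * g.delta)) 1) q⁻¹ := by
    have := h (q * g.gcd (q⁻¹ * (x⁻¹ * g.delta)) 1) ?_ ?_ ?_
    · rw [← inv_eq_of_mul_eq_one_right this]
      exact le_refl _
    · rw [← one_le_iff, ← mul_le_mul_left_iff q⁻¹, mul_one, inv_mul_cancel_left]
      refine le_gcd ?_ ?_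
      · simpa [Le] using hx.2
      · simpa [Le] using hq
    · rw [← mul_le_mul_left_iff q⁻¹, inv_mul_cancel_left]
      exact gcd_le_left _ _
    · rw [← mul_le_mul_left_iff q⁻¹, inv_mul_cancel_left, inv_mul_cancel]
      exact gcd_le_right _ _
  -- The two bounds on w say exactly that wΔ^{-n} divides both arguments of this gcd.
  have h₂ : g.Le (w * g.delta ^ (-n)) (g.gcd (q⁻¹ * (x⁻¹ * g.delta)) 1) := by
    refine le_gcd ?_ ?_
    · rw [← mul_delta_zpow_le_iff n, ← mul_le_mul_left_iff (x * q)]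
      convert hle using 1
      · simp [mul_assoc]
      · simp [mul_assoc, zpow_add, (Commute.self_zpow g.delta n).eq]
    · rw [← mul_delta_zpow_le_iff n]
      simpa [mul_assoc] using hw
  have h₃ := h₂.trans h₁
  rw [← mul_le_mul_left_iff q, ← mul_delta_zpow_le_iff n] at h₃
  simpa [mul_assoc] using h₃

theorem prod_le_delta_pow {l : List G} (hl : ∀ t ∈ l, g.IsSimple t) :
    g.Le l.prod (g.delta ^ (l.length : ℤ)) := by
  induction l with
  | nil => simpa using le_refl 1
  | cons t l ih =>
    have h₁ := ih fun t ht => hl t (by simp [ht])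
    have h₂ := (mul_le_mul_left_iff t).2 h₁
    rw [← List.prod_cons] at h₂
    refine h₂.trans ?_
    rw [List.length_cons, Nat.cast_succ, add_comm, zpow_add, zpow_one, mul_delta_zpow_le_iff]
    exact (hl t (by simp)).2

/-- If `x₁ ⋯ xᵣ` is left weighted and `x₁ ⋯ xᵣ w ≼ Δ^r` with `w` simple, then `xᵣ w ≼ Δ`. -/
theorem getLast_mul_le {x : G} {l : List G} (hl : ∀ t ∈ x :: l, g.IsSimple t)
    (h : (x :: l).IsChain g.LeftWeighted) {w : G} (hw : g.Le w g.delta)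
    (hle : g.Le ((x :: l).prod * w) (g.delta ^ (((x :: l).length : ℕ) : ℤ))) :
    g.Le ((x :: l).getLast (by simp) * w) g.delta := by
  induction l generalizing x with
  | nil => simpa using hle
  | cons y l ih =>
    have hy : ∀ t ∈ y :: l, g.IsSimple t := fun t ht => hl t (List.mem_cons_of_mem _ ht)
    rw [List.getLast_cons (by simp)]
    refine ih hy h.of_cons ?_
    -- The first factor is cancelled together with one power of Δ; the role of q is played by the
    -- product of the remaining factors.
    refine (LeftWeighted.prod (hl x (by simp)) hy h).mul_le_delta_zpow (hl x (by simp))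
      (Submonoid.list_prod_mem _ fun t ht => (hy t ht).mem) ?_ ?_
    · refine hw.trans ?_
      simpa using delta_zpow_le (g := g) (m := 1) (n := (y :: l).length) (by simp)
    · simpa [mul_assoc] using hle

/-! ### Left normal forms -/

/-- The factors of a left normal form. -/
def IsNormal (g : GarsideStructure G) (l : List G) : Prop :=
  (∀ t ∈ l, g.IsSimple t ∧ t ≠ 1 ∧ t ≠ g.delta) ∧ l.IsChain g.LeftWeighted

theorem IsNormal.of_cons {x : G} {l : List G} (h : g.IsNormal (x :: l)) : g.IsNormal l :=
  ⟨fun t ht => h.1 t (List.mem_cons_of_mem _ ht), h.2.of_cons⟩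

theorem IsNormal.isSimple {l : List G} (h : g.IsNormal l) : ∀ t ∈ l, g.IsSimple t :=
  fun t ht => (h.1 t ht).1

theorem IsNormal.prod_mem {l : List G} (h : g.IsNormal l) : l.prod ∈ g.P :=
  Submonoid.list_prod_mem _ fun t ht => (h.isSimple t ht).mem

theorem isNormal_nil : g.IsNormal [] := ⟨by simp, .nil⟩

theorem IsNormal.le_head {x : G} {l : List G} (h : g.IsNormal (x :: l)) {e : G}
    (he : g.Le e g.delta) (hle : g.Le e (x :: l).prod) : g.Le e x :=
  le_of_isChain (h.isSimple x (by simp)) h.of_cons.isSimple h.2 he (by simpa using hle)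

theorem IsNormal.not_delta_le [Nontrivial G] {l : List G} (h : g.IsNormal l) :
    ¬ g.Le g.delta l.prod := by
  intro hle
  cases l with
  | nil => exact delta_ne_one (eq_one_of_le_one g.delta_mem hle)
  | cons x l =>
    have hx := h.1 x (by simp)
    exact hx.2.2 (hx.1.2.antisymm (h.le_head (le_refl _) hle))

/-- Otherwise the last factor y would satisfy yΔ ≼ Δ and be trivial. This is the minimality half of
the formula for sup. -/
theorem IsNormal.not_mul_delta_le [Nontrivial G] {l : List G} (h : g.IsNormal l) :
    ¬ g.Le (l.prod * g.delta) (g.delta ^ (l.length : ℤ)) := by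
  intro hle
  cases l with
  | nil => exact delta_ne_one (eq_one_of_le_one g.delta_mem (by simpa using hle))
  | cons x l =>
    have h₁ := getLast_mul_le h.isSimple h.2 (le_refl g.delta) hle
    have hx := h.1 _ (List.getLast_mem (l := x :: l) (by simp))
    refine hx.2.1 (eq_one_of_le_one hx.1.mem ?_)
    rwa [← mul_delta_le_iff, one_mul]

theorem IsNormal.inf_eq [Nontrivial G] {l : List G} (h : g.IsNormal l) (p : ℤ) :
    g.inf (g.delta ^ p * l.prod) = p := by
  refine IsGreatest.csSup_eq ⟨le_mul_right _ h.prod_mem, fun q hq => ?_⟩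
  by_contra! hlt
  refine h.not_delta_le ?_
  rw [← mul_le_mul_left_iff (g.delta ^ p), ← zpow_add_one]
  exact (delta_zpow_le (by omega)).trans hq

theorem IsNormal.sup_eq [Nontrivial G] {l : List G} (h : g.IsNormal l) (p : ℤ) :
    g.sup (g.delta ^ p * l.prod) = p + l.length := by
  refine IsLeast.csInf_eq ⟨?_, fun q hq => ?_⟩
  · change g.Le _ _
    rw [zpow_add, mul_le_mul_left_iff]
    exact prod_le_delta_pow h.isSimple
  · by_contra! hlt
    refine h.not_mul_delta_le ?_
    have : g.Le _ _ := hq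
    rw [← mul_le_mul_left_iff (g.delta ^ p), ← mul_assoc, ← zpow_add]
    refine (mul_delta_le_iff.2 this).trans ?_
    rw [← zpow_add_one]
    exact delta_zpow_le (by omega)

/-- Comparing sup gives equal lengths; then each head is a simple prefix of the common product, so
each absorbs the other. -/
theorem IsNormal.eq_of_prod_eq [Nontrivial G] {l m : List G} (hl : g.IsNormal l)
    (hm : g.IsNormal m) (h : l.prod = m.prod) : l = m := by
  have hlen : l.length = m.length := by
    have h₁ := hl.sup_eq 0
    have h₂ := hm.sup_eq 0
    rw [h] at h₁
    omega
  induction l generalizing m with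
  | nil => exact (List.length_eq_zero_iff.1 hlen.symm).symm
  | cons x l ih =>
    cases m with
    | nil => simp at hlen
    | cons y m =>
      have h₁ : x = y := by
        refine Le.antisymm (hm.le_head (hl.isSimple x (by simp)).2 ?_)
          (hl.le_head (hm.isSimple y (by simp)).2 ?_)
        · rw [← h, List.prod_cons]; exact le_mul_right _ hl.of_cons.prod_mem
        · rw [h, List.prod_cons]; exact le_mul_right _ hm.of_cons.prod_mem
      subst h₁
      rw [ih hl.of_cons hm.of_cons (by simpa using h) (by simpa using hlen)]

theorem IsNormal.eq_of_eq [Nontrivial G] {l m : List G} (hl : g.IsNormal l) (hm : g.IsNormal m)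
    {p q : ℤ} (h : g.delta ^ p * l.prod = g.delta ^ q * m.prod) : p = q ∧ l = m := by
  have hpq : p = q := by rw [← hl.inf_eq p, h, hm.inf_eq q]
  subst hpq
  exact ⟨rfl, hl.eq_of_prod_eq hm (mul_left_cancel h)⟩

/-! ### The preferred prefix -/

theorem prefPrefix_delta_zpow [Nontrivial G] (p : ℤ) : g.prefPrefix (g.delta ^ p) = 1 := by
  have h₁ := (isNormal_nil (g := g)).inf_eq p
  have h₂ := (isNormal_nil (g := g)).sup_eq p
  simp only [List.prod_nil, mul_one, List.length_nil, Nat.cast_zero, add_zero] at h₁ h₂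
  simp only [prefPrefix, h₁, h₂, zpow_neg, mul_inv_cancel, inv_mul_cancel]
  have h : g.Le 1 (g.gcd 1 1) := le_gcd (le_refl _) (le_refl _)
  exact ((gcd_le_left _ _).trans (gcd_le_left _ _)).antisymm
    (le_gcd h (one_le_iff.2 g.delta_mem))

/-- Among simple elements, the prefixes of xΔ^{-inf x} are those of the initial factor τ^{-p}(x₁),
and the prefixes of x⁻¹Δ^{sup x} are those of ∂(xᵣ). The condition of dividing Δ is then automatic.
-/
theorem IsNormal.prefPrefix_eq [Nontrivial G] {x : G} {l : List G} (h : g.IsNormal (x :: l))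
    (p : ℤ) : g.prefPrefix (g.delta ^ p * (x :: l).prod) =
      g.gcd ((g.delta ^ (-p))⁻¹ * x * g.delta ^ (-p))
        (((x :: l).getLast (by simp))⁻¹ * g.delta) := by
  rw [prefPrefix, h.inf_eq, h.sup_eq]
  have hx := h.isSimple x (by simp)
  set y := (x :: l).getLast (by simp) with hy
  have hy' : g.IsSimple y := h.isSimple y (List.getLast_mem _)
  have e₁ : g.delta ^ p * (x :: l).prod * g.delta ^ (-p) =
      g.delta ^ p * (x * l.prod * g.delta ^ (-p)) := by simp [mul_assoc]
  have e₂ : (g.delta ^ (-p))⁻¹ * x * g.delta ^ (-p) = g.delta ^ p * (x * g.delta ^ (-p)) := by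
    simp [mul_assoc]
  have e₃ : (g.delta ^ p * (x :: l).prod)⁻¹ * g.delta ^ (p + ((x :: l).length : ℤ)) =
      (x :: l).prod⁻¹ * g.delta ^ ((x :: l).length : ℤ) := by
    rw [zpow_add]; group
  rw [e₁, e₂, e₃]
  apply Le.antisymm
  · have h₁ : g.Le (g.gcd (g.gcd (g.delta ^ p * (x * l.prod * g.delta ^ (-p)))
      ((x :: l).prod⁻¹ * g.delta ^ ((x :: l).length : ℤ))) g.delta) g.delta := gcd_le_right _ _
    have h₂ := (gcd_le_left (g.gcd (g.delta ^ p * (x * l.prod * g.delta ^ (-p)))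
      ((x :: l).prod⁻¹ * g.delta ^ ((x :: l).length : ℤ))) g.delta).trans (gcd_le_left _ _)
    have h₃ := (gcd_le_left (g.gcd (g.delta ^ p * (x * l.prod * g.delta ^ (-p)))
      ((x :: l).prod⁻¹ * g.delta ^ ((x :: l).length : ℤ))) g.delta).trans (gcd_le_right _ _)
    generalize g.gcd (g.gcd (g.delta ^ p * (x * l.prod * g.delta ^ (-p)))
      ((x :: l).prod⁻¹ * g.delta ^ ((x :: l).length : ℤ))) g.delta = d at h₁ h₂ h₃ ⊢
    refine le_gcd ?_ ?_
    -- Conjugation by Δ^p moves d in front of x₁ ⋯ xᵣ, where the head absorbs it.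
    · rw [← mul_le_mul_left_iff (g.delta ^ (-p)), ← mul_delta_zpow_le_iff p]
      have h₄ := h.le_head (e := g.delta ^ (-p) * d * g.delta ^ p) ?_ ?_
      · convert h₄ using 1
        simp [mul_assoc]
      · have := (mul_delta_zpow_le_iff p).2 ((mul_le_mul_left_iff (g.delta ^ (-p))).2 h₁)
        refine this.trans ?_
        rw [mul_assoc, (Commute.self_zpow g.delta p).eq, ← mul_assoc]
        simpa using le_refl _
      · have := (mul_delta_zpow_le_iff p).2 ((mul_le_mul_left_iff (g.delta ^ (-p))).2 h₂)
        refine this.trans ?_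
        simpa [mul_assoc] using le_refl _
    · rw [← mul_le_mul_left_iff y, mul_inv_cancel_left]
      refine getLast_mul_le h.isSimple h.2 h₁ ?_
      rw [← mul_le_mul_left_iff (x :: l).prod, mul_inv_cancel_left] at h₃
      exact h₃
  · have h₁ := gcd_le_left (g := g) (g.delta ^ p * (x * g.delta ^ (-p))) (y⁻¹ * g.delta)
    have h₂ := gcd_le_right (g := g) (g.delta ^ p * (x * g.delta ^ (-p))) (y⁻¹ * g.delta)
    refine le_gcd (le_gcd (h₁.trans ?_) (h₂.trans ?_)) (h₂.trans hy'.rightCompl.2)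
    · rw [mul_le_mul_left_iff, mul_delta_zpow_le_iff]
      exact le_mul_right _ h.of_cons.prod_mem
    -- All factors but the last divide Δ^{r-1}, so what remains to be filled up to Δ^r starts with
    -- ∂(xᵣ).
    · have hd : (x :: l).prod = (x :: l).dropLast.prod * y := by
        conv_lhs => rw [← List.dropLast_append_getLast (l := x :: l) (by simp)]
        rw [List.prod_append, List.prod_singleton, ← hy]
      have hle := prod_le_delta_pow (g := g) (l := (x :: l).dropLast)
        fun t ht => h.isSimple t (List.mem_of_mem_dropLast ht)
      rw [hd, mul_inv_rev, mul_assoc, mul_le_mul_left_iff, ← mul_le_mul_left_iff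
        (x :: l).dropLast.prod, mul_inv_cancel_left]
      have := mul_delta_le_iff.2 hle
      rwa [← zpow_add_one, List.length_dropLast, List.length_cons, Nat.add_sub_cancel,
        ← Nat.cast_succ] at this

/-! ### Sliding does not lower inf or raise sup -/

theorem conj_bounds {x u : G} {a b : ℤ} (hu : u ∈ g.P)
    (h₁ : g.Le u (x * g.delta ^ (-a))) (h₂ : g.Le u (x⁻¹ * g.delta ^ b)) :
    g.Le (g.delta ^ a) (u⁻¹ * x * u) ∧ g.Le (u⁻¹ * x * u) (g.delta ^ b) := by
  constructor
  -- Here Δ^{-a}u⁻¹xu is the conjugate by Δ^a of the positive element u⁻¹xΔ^{-a}, times u.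
  · have := g.P.mul_mem ((conj_delta_zpow_mem_iff a _).2 h₁) hu
    simpa [Le, mul_assoc] using this
  · have := g.P.mul_mem h₂ ((conj_delta_zpow_mem_iff b _).2 hu)
    simpa [Le, mul_assoc] using this

theorem IsNormal.bounds [Nontrivial G] {l : List G} (h : g.IsNormal l) {p a b : ℤ}
    (h₁ : g.Le (g.delta ^ a) (g.delta ^ p * l.prod))
    (h₂ : g.Le (g.delta ^ p * l.prod) (g.delta ^ b)) : a ≤ p ∧ p + l.length ≤ b := by
  constructor
  · by_contra! hlt
    refine h.not_delta_le ?_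
    rw [← mul_le_mul_left_iff (g.delta ^ p), ← zpow_add_one]
    exact (delta_zpow_le (by omega)).trans h₁
  · by_contra! hlt
    refine h.not_mul_delta_le ?_
    rw [← mul_le_mul_left_iff (g.delta ^ p), ← mul_assoc, ← zpow_add]
    refine (mul_delta_le_iff.2 h₂).trans ?_
    rw [← zpow_add_one]
    exact delta_zpow_le (by omega)

/-- The first two terms in the definition of 𝔭(x) are exactly the hypotheses of `conj_bounds` for a
= inf x and b = sup x. A fixed interval therefore contains the whole trajectory. -/
theorem IsNormal.slide_bounds [Nontrivial G] {l : List G} (h : g.IsNormal l) {p a b : ℤ} {x : G}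
    (hx : x = g.delta ^ p * l.prod)
    (h₁ : g.Le (g.delta ^ a) x) (h₂ : g.Le x (g.delta ^ b)) :
    g.Le (g.delta ^ a) (g.slide x) ∧ g.Le (g.slide x) (g.delta ^ b) := by
  have hinf := h.inf_eq p
  have hsup := h.sup_eq p
  rw [← hx] at hinf hsup
  have h₃ : g.Le (g.delta ^ p) x := hx ▸ le_mul_right _ h.prod_mem
  have h₄ : g.Le x (g.delta ^ (p + (l.length : ℤ))) := by
    rw [hx, zpow_add, mul_le_mul_left_iff]
    exact prod_le_delta_pow h.isSimple
  obtain ⟨hap, hpb⟩ := h.bounds (hx ▸ h₁) (hx ▸ h₂)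
  have h₅ : g.Le 1 (x * g.delta ^ (-p)) := by
    rw [one_le_iff, ← conj_delta_zpow_mem_iff p]
    simpa [Le, mul_assoc] using h₃
  have h₆ : g.Le 1 (x⁻¹ * g.delta ^ (p + (l.length : ℤ))) := one_le_iff.2 h₄
  have key := conj_bounds (g := g) (x := x) (u := g.prefPrefix x) (a := p) (b := p + l.length)
    ?_ ?_ ?_
  · exact ⟨(delta_zpow_le hap).trans key.1, key.2.trans (delta_zpow_le hpb)⟩
  all_goals rw [prefPrefix, hinf, hsup]
  · exact one_le_iff.1 (le_gcd (le_gcd h₅ h₆) (one_le_iff.2 g.delta_mem))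
  · exact (gcd_le_left _ _).trans (gcd_le_left _ _)
  · exact (gcd_le_left _ _).trans (gcd_le_right _ _)

/-! ### Local slidings -/

/-- `s' t'` arises from `s t` by a local sliding. -/
structure IsSliding (g : GarsideStructure G) (s t s' t' : G) : Prop where
  isSimple_left : g.IsSimple s'
  isSimple_right : g.IsSimple t'
  mul_eq : s' * t' = s * t
  le : g.Le s s'
  leftWeighted : g.LeftWeighted s' t'

theorem IsSliding.exists_eq {s t s' t' : G} (h : g.IsSliding s t s' t') :
    ∃ u ∈ g.P, s' = s * u ∧ t = u * t' := by
  refine ⟨s⁻¹ * s', h.le, by simp, ?_⟩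
  rw [mul_assoc, h.mul_eq, inv_mul_cancel_left]

theorem LeftWeighted.eq_delta {s : G} (hs : g.IsSimple s) (h : g.LeftWeighted s g.delta) :
    s = g.delta :=
  inv_mul_eq_one.1 (h _ hs.2 (le_refl _) hs.rightCompl.2)

/-- The second domino rule. -/
theorem LeftWeighted.domino {x₁ x₂ u y₁ y₂ x₁' y₁' : G} (h : g.LeftWeighted x₁ x₂)
    (hx₁ : g.IsSimple x₁) (hx₂ : g.IsSimple x₂) (hu : g.IsSimple u)
    (h₂ : g.IsSliding x₂ u y₁ y₂) (h₁ : g.IsSliding x₁ y₁ x₁' y₁') : g.LeftWeighted y₁' y₂ := by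
  intro e he he₁ he₂
  obtain ⟨v, hv, rfl, rfl⟩ := h₂.exists_eq
  refine h₂.leftWeighted e he ?_ he₂
  have hve : g.Le (v * e) g.delta := ((mul_le_mul_left_iff v).2 he₂).trans hu.2
  rw [← mul_le_mul_left_iff (x₂ * v), mul_inv_cancel_left, mul_assoc]
  -- Since x₁x₂v = x₁'y₁', the assumption on e gives x₁x₂ve ≼ x₁'Δ ≼ Δ². As x₁, x₂ is left weighted,
  -- x₁ can be cancelled against one Δ.
  have := h.mul_le_delta_zpow (n := 1) (w := v * e) hx₁ hx₂.mem (by simpa using hve) ?_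
  · simpa using this
  · rw [← mul_le_mul_left_iff y₁', mul_inv_cancel_left, ← mul_le_mul_left_iff x₁'] at he₁
    have h₃ := he₁.trans (mul_delta_le_iff.2 h₁.isSimple_left.2)
    rw [← mul_assoc, h₁.mul_eq] at h₃
    convert h₃ using 1
    · simp [mul_assoc]
    · rw [zpow_add_one, zpow_one]

/-- A left weighted sequence in which only the first factor may be `Δ`, and only the last factor
may be `1`. -/
structure IsAlmostNormal (g : GarsideStructure G) (y : G) (ys : List G) : Prop where
  isSimple : ∀ t ∈ y :: ys, g.IsSimple t
  isChain : (y :: ys).IsChain g.LeftWeighted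
  ne_one : ∀ t ∈ (y :: ys).dropLast, t ≠ 1
  ne_delta : ∀ t ∈ ys, t ≠ g.delta

/-- `InsRight l s y ys` means that pushing `s` into `l` by local slidings from right to left gives
the sequence `y, ys`. -/
inductive InsRight (g : GarsideStructure G) : List G → G → G → List G → Prop
  | nil (s : G) : InsRight g [] s s []
  | cons {x s y x' y' : G} {l ys : List G} : InsRight g l s y ys → g.IsSliding x y x' y' →
      InsRight g (x :: l) s x' (y' :: ys)

/-- `InsLeft s l y ys` means that pushing `s` into `l` by local slidings from left to right gives
the sequence `y, ys`. -/
inductive InsLeft (g : GarsideStructure G) : G → List G → G → List G → Prop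
  | nil (s : G) : InsLeft g s [] s []
  | cons {s x s' x' y : G} {l ys : List G} : g.IsSliding s x s' x' → InsLeft g x' l y ys →
      InsLeft g s (x :: l) s' (y :: ys)

theorem InsRight.length_eq {s y : G} {l ys : List G} (h : g.InsRight l s y ys) :
    ys.length = l.length := by
  induction h with
  | nil s => rfl
  | cons _ _ ih => simp [ih]

theorem InsRight.prod_eq {s y : G} {l ys : List G} (h : g.InsRight l s y ys) :
    y * ys.prod = l.prod * s := by
  induction h with
  | nil s => simp
  | cons _ hs ih => rw [List.prod_cons, List.prod_cons, ← mul_assoc, hs.mul_eq, mul_assoc, ih,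
      mul_assoc]

theorem InsLeft.length_eq {s y : G} {l ys : List G} (h : g.InsLeft s l y ys) :
    ys.length = l.length := by
  induction h with
  | nil s => rfl
  | cons _ _ ih => simp [ih]

theorem InsLeft.prod_eq {s y : G} {l ys : List G} (h : g.InsLeft s l y ys) :
    y * ys.prod = s * l.prod := by
  induction h with
  | nil s => simp
  | cons hs _ ih => rw [List.prod_cons, List.prod_cons, ih, ← mul_assoc, hs.mul_eq, mul_assoc]

/-- The head is modified by the following sliding, so weightedness behind it must be known in
advance for every such sliding: this third claim is where the domino rule enters. The second claim,
that heads only grow, keeps inner factors nontrivial. -/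
theorem InsRight.isAlmostNormal_aux {s y : G} {l ys : List G} (h : g.InsRight l s y ys)
    (hl : g.IsNormal l) (hs : g.IsSimple s) :
    g.IsAlmostNormal y ys ∧ (∀ x ∈ l.head?, g.Le x y) ∧
      ∀ x x' y', g.IsSimple x → (x :: l).IsChain g.LeftWeighted → g.IsSliding x y x' y' →
        (y' :: ys).IsChain g.LeftWeighted := by
  induction h with
  | nil s => exact ⟨⟨by simpa using hs, by simp, by simp, by simp⟩, by simp, by simp⟩
  | @cons x s y₀ y y₁ l ys₀ h₀ hsl ih =>
    obtain ⟨ih₁, ih₂, ih₃⟩ := ih hl.of_cons hs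
    have hx := hl.1 x (by simp)
    have hch := ih₃ x y y₁ hx.1 hl.2 hsl
    refine ⟨⟨?_, ?_, ?_, ?_⟩, ?_, ?_⟩
    · intro t ht
      simp only [List.mem_cons] at ht
      rcases ht with rfl | rfl | ht
      · exact hsl.isSimple_left
      · exact hsl.isSimple_right
      · exact ih₁.isSimple t (by simp [ht])
    · exact List.isChain_cons_cons.2 ⟨hsl.leftWeighted, hch⟩
    · have hy : y ≠ 1 := fun h => hx.2.1 (eq_one_of_le_one hx.1.mem (h ▸ hsl.le))
      cases ys₀ with
      | nil => simpa using hy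
      | cons z zs =>
        cases l with
        | nil => simpa using h₀.length_eq
        | cons x₂ l =>
          have hx₂ := hl.1 x₂ (by simp)
          -- If y₁ = 1, then x x₂ ≼ x y₀ = y ≼ Δ, so x₂ ≼ ∂(x), against weightedness of x, x₂.
          have hy₁ : y₁ ≠ 1 := by
            rintro rfl
            refine hx₂.2.1 ((List.isChain_cons_cons.1 hl.2).1 x₂ hx₂.1.mem ?_ (le_refl _))
            rw [← mul_le_mul_left_iff x, mul_inv_cancel_left]
            refine ((mul_le_mul_left_iff x).2 (ih₂ x₂ (by simp))).trans ?_
            rw [← hsl.mul_eq, mul_one]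
            exact hsl.isSimple_left.2
          intro t ht
          simp only [List.dropLast_cons_cons, List.mem_cons] at ht
          rcases ht with rfl | rfl | ht
          · exact hy
          · exact hy₁
          · exact ih₁.ne_one t (by simp [ht])
    · intro t ht
      simp only [List.mem_cons] at ht
      rcases ht with rfl | ht
      -- If the new second factor is Δ, then y₀ = uΔ is simple, so u = 1 and x, Δ is left weighted;
      -- this forces x = Δ.
      · rintro rfl
        obtain ⟨u, hu, rfl, rfl⟩ := hsl.exists_eq
        have h₁ : g.Le (u * g.delta) g.delta := (ih₁.isSimple (u * g.delta) (by simp)).2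
        have h₂ : u = 1 := eq_one_of_le_one hu (by rwa [← mul_delta_le_iff, one_mul])
        subst h₂
        have h₃ := hsl.leftWeighted
        rw [mul_one] at h₃
        exact hx.2.2 (h₃.eq_delta hx.1)
      · exact ih₁.ne_delta t ht
    · simpa using hsl.le
    · intro w w' y₁' hw hwch hsl'
      refine List.isChain_cons_cons.2 ⟨?_, hch⟩
      exact (List.isChain_cons_cons.1 hwch).1.domino hw hx.1 (ih₁.isSimple y₀ (by simp)) hsl hsl'

theorem InsRight.isAlmostNormal {s y : G} {l ys : List G} (h : g.InsRight l s y ys)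
    (hl : g.IsNormal l) (hs : g.IsSimple s) : g.IsAlmostNormal y ys :=
  (h.isAlmostNormal_aux hl hs).1

/-- A pass from left to right never alters an earlier factor again, so no domino rule is needed. The
second claim says that the head can only become Δ if the old first factor contains ∂(s); it serves
to exclude Δ from later positions. -/
theorem InsLeft.isAlmostNormal_aux {s y : G} {l ys : List G} (h : g.InsLeft s l y ys)
    (hl : g.IsNormal l) (hs : g.IsSimple s) :
    g.IsAlmostNormal y ys ∧ (y = g.delta → ∀ x ∈ l.head?, g.Le (s⁻¹ * g.delta) x) := by
  induction h with
  | nil s => exact ⟨⟨by simpa using hs, by simp, by simp, by simp⟩, by simp⟩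
  | @cons s x s' x' y l ys hsl h₀ ih =>
    obtain ⟨ih₁, ih₂⟩ := ih hl.of_cons hsl.isSimple_right
    have hx := hl.1 x (by simp)
    obtain ⟨u, hu, hs', hx'⟩ := hsl.exists_eq
    -- For e dividing ∂(s') and y, the element ue is a simple prefix of the old product x ⋯, hence
    -- of x = ux'. So e divides x', and s', x' is left weighted.
    have hlw : g.LeftWeighted s' y := by
      intro e he he₁ he₂
      refine hsl.leftWeighted e he he₁ ?_
      rw [← mul_le_mul_left_iff u, ← hx']
      refine hl.le_head ?_ ?_
      · rw [hs', ← mul_le_mul_left_iff (s * u), mul_inv_cancel_left, mul_assoc] at he₁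
        rw [← mul_le_mul_left_iff s]
        refine he₁.trans ?_
        have := (mul_delta_le_iff (a := 1)).2 (one_le_iff.2 hs.mem)
        simpa using this
      · rw [List.prod_cons, hx', mul_assoc, mul_le_mul_left_iff, ← h₀.prod_eq]
        refine he₂.trans (le_mul_right _ (Submonoid.list_prod_mem _ fun t ht => ?_))
        exact (ih₁.isSimple t (by simp [ht])).mem
    refine ⟨⟨?_, ?_, ?_, ?_⟩, ?_⟩
    · intro t ht
      rcases List.mem_cons.1 ht with rfl | ht
      · exact hsl.isSimple_left
      · exact ih₁.isSimple t ht
    · exact List.isChain_cons_cons.2 ⟨hlw, ih₁.isChain⟩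
    · intro t ht
      rw [List.dropLast_cons_cons, List.mem_cons] at ht
      rcases ht with rfl | ht
      · rintro rfl
        have hs₁ : s = 1 := eq_one_of_le_one hs.mem hsl.le
        have hxx : x' = x := by simpa [hs₁] using hsl.mul_eq
        refine hx.2.1 (hsl.leftWeighted x hx.1.mem ?_ (hxx ▸ le_refl _))
        simpa using hx.1.2
      · exact ih₁.ne_one t ht
    · intro t ht
      rcases List.mem_cons.1 ht with rfl | ht
      · rintro rfl
        have hsd : s' = g.delta := hlw.eq_delta hsl.isSimple_left
        cases h₀ with
        | nil =>
          have h₁ : u = 1 := eq_one_of_le_one hu (by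
            rw [← mul_delta_le_iff, one_mul, ← hx']; exact hx.1.2)
          exact hx.2.2 (by simpa [h₁] using hx')
        | @cons _ x₂ _ _ _ l _ _ _ =>
          -- Here ∂(x) ≼ ∂(x') ≼ x₂ because x' is a right factor of x; weightedness of x, x₂ then
          -- makes ∂(x) trivial.
          have h₁ := ih₂ rfl x₂ (by simp)
          have h₂ := (List.isChain_cons_cons.1 hl.2).1 _ hx.1.2 (le_refl _) (Le.trans ?_ h₁)
          · exact hx.2.2 (inv_mul_eq_one.1 h₂)
          · rw [hx', Le]
            have := (g.conj_delta_mem_iff u).2 hu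
            simpa [mul_assoc] using this
      · exact ih₁.ne_delta t ht
    · rintro rfl z hz
      obtain rfl : x = z := by simpa using hz
      rw [hs', inv_mul_cancel_left, hx']
      exact le_mul_right _ hsl.isSimple_right.mem

theorem InsLeft.isAlmostNormal {s y : G} {l ys : List G} (h : g.InsLeft s l y ys)
    (hl : g.IsNormal l) (hs : g.IsSimple s) : g.IsAlmostNormal y ys :=
  (h.isAlmostNormal_aux hl hs).1

/-! ### Removing a trivial last factor; conjugating by powers of Δ -/

theorem isNormal_dropLast {l : List G} (hs : ∀ t ∈ l, g.IsSimple t)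
    (hc : l.IsChain g.LeftWeighted) (h₁ : ∀ t ∈ l.dropLast, t ≠ 1) (hd : ∀ t ∈ l, t ≠ g.delta) :
    g.IsNormal l.dropLast :=
  ⟨fun t ht => ⟨hs t (List.mem_of_mem_dropLast ht), h₁ t ht, hd t (List.mem_of_mem_dropLast ht)⟩,
    hc.prefix (List.dropLast_prefix l)⟩

theorem isNormal_of_getLast {l : List G} (hs : ∀ t ∈ l, g.IsSimple t)
    (hc : l.IsChain g.LeftWeighted) (h₁ : ∀ t ∈ l.dropLast, t ≠ 1) (hd : ∀ t ∈ l, t ≠ g.delta)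
    (h : ∀ t ∈ l.getLast?, t ≠ 1) : g.IsNormal l := by
  refine ⟨fun t ht => ⟨hs t ht, ?_, hd t ht⟩, hc⟩
  have hne : l ≠ [] := List.ne_nil_of_mem ht
  rw [← List.dropLast_append_getLast hne, List.mem_append, List.mem_singleton] at ht
  rcases ht with ht | rfl
  · exact h₁ t ht
  · exact h _ (List.getLast?_eq_some_getLast hne)

/-- Conjugation by Δ^n is an automorphism of the prefix order fixing Δ. It is needed to carry Δ⁻¹
leftwards through all factors when multiplying by s⁻¹. -/
theorem IsNormal.conj_delta {l : List G} (h : g.IsNormal l) (n : ℤ) :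
    g.IsNormal (l.map fun s => (g.delta ^ n)⁻¹ * s * g.delta ^ n) := by
  refine ⟨?_, ?_⟩
  · simp only [List.mem_map]
    rintro _ ⟨s, hs, rfl⟩
    obtain ⟨h₁, h₂, h₃⟩ := h.1 s hs
    have hc := (Commute.self_zpow g.delta n).eq
    refine ⟨h₁.conj_delta n, fun h => h₂ ?_, fun h => h₃ ?_⟩
    · rwa [mul_assoc, inv_mul_eq_one, eq_comm, mul_eq_right] at h
    · rw [mul_assoc, inv_mul_eq_iff_eq_mul, ← hc] at h
      exact mul_right_cancel h
  · rw [List.isChain_map]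
    refine h.2.imp fun s t hst e he h₁ h₂ => ?_
    have hc := (Commute.self_zpow g.delta n).eq
    have := hst (g.delta ^ n * e * g.delta ^ (-n)) ?_ ?_ ?_
    · rwa [mul_assoc, zpow_neg, ← eq_inv_mul_iff_mul_eq, mul_one, mul_eq_right] at this
    · rw [← conj_delta_zpow_mem_iff n]
      simpa [mul_assoc] using he
    · rw [← mul_le_mul_left_iff (g.delta ^ n), ← mul_delta_zpow_le_iff (-n)] at h₁
      convert h₁ using 1
      simp only [mul_inv_rev, inv_inv, zpow_neg, mul_assoc]
      rw [← zpow_neg, (Commute.self_zpow g.delta (-n)).eq]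
      simp
    · rw [← mul_le_mul_left_iff (g.delta ^ n), ← mul_delta_zpow_le_iff (-n)] at h₂
      convert h₂ using 1
      simp [mul_assoc]

end GarsideStructure

/-! ### Total correctness with cost bounds -/

/-- The computation `m` returns a result that satisfies `Q`, at cost at most `B`. -/
def Spec {α : Type} (m : Timed α) (B : ℕ) (Q : α → Prop) : Prop :=
  ∃ a c, c ≤ B ∧ Q a ∧ ∀ t, (a, t + c) ∈ m t

namespace Spec

variable {α β σ : Type}

theorem mono {m : Timed α} {B B' : ℕ} {Q R : α → Prop} (h : Spec m B Q) (hB : B ≤ B')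
    (hQ : ∀ a, Q a → R a) : Spec m B' R := by
  obtain ⟨a, c, hc, ha, h⟩ := h
  exact ⟨a, c, hc.trans hB, hQ a ha, h⟩

theorem pure {a : α} {B : ℕ} {Q : α → Prop} (h : Q a) : Spec (Pure.pure a : Timed α) B Q :=
  ⟨a, 0, Nat.zero_le _, h, fun _ => Part.mem_some _⟩

theorem bind {m : Timed α} {f : α → Timed β} {B B' B'' : ℕ} {Q : α → Prop} {R : β → Prop}
    (h : Spec m B Q) (hB : B + B' ≤ B'') (hf : ∀ a, Q a → Spec (f a) B' R) :
    Spec (m >>= f) B'' R := by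
  obtain ⟨a, c, hc, ha, h⟩ := h
  obtain ⟨b, d, hd, hb, h'⟩ := hf a ha
  refine ⟨b, c + d, by omega, hb, fun t => ?_⟩
  have := Part.mem_bind (g := fun p : α × ℕ => f p.1 p.2) (h t) (h' (t + c))
  rwa [add_assoc] at this

theorem tick (n : ℕ) : Spec (tick n) n fun _ => True :=
  ⟨(), n, le_rfl, trivial, fun _ => Part.mem_some _⟩

theorem tick_bind {f : Unit → Timed β} {n B B' : ℕ} {R : β → Prop} (hB : n + B ≤ B')
    (hf : Spec (f ()) B R) : Spec (Garside.tick n >>= f) B' R :=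
  bind (tick n) hB fun _ _ => hf

/-- The rule for loops, where `I s n` says that the invariant holds in the state `s` and that at
most `n` further passes return to the head of the loop. -/
theorem loop {body : σ → Timed (α ⊕ σ)} {B : ℕ} {Q : α → Prop} (I : σ → ℕ → Prop)
    (h : ∀ s n, I s n → Spec (body s) B (Sum.elim Q fun s' => ∃ n', n = n' + 1 ∧ I s' n'))
    {s : σ} {n : ℕ} (hs : I s n) : Spec (loop body s) ((n + 1) * B) Q := by
  induction n generalizing s with
  | zero =>
    obtain ⟨a, c, hc, ha, hm⟩ := h s 0 hs
    cases a with
    | inr s' => obtain ⟨n', h, _⟩ := ha; omega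
    | inl a =>
      refine ⟨a, c, by omega, ha, fun t => ?_⟩
      exact PFun.mem_fix_iff.2 (.inl (Part.mem_map_iff _ |>.2 ⟨_, hm t, rfl⟩))
  | succ n ih =>
    obtain ⟨a, c, hc, ha, hm⟩ := h s _ hs
    cases a with
    | inl a =>
      refine ⟨a, c, by nlinarith, ha, fun t => ?_⟩
      exact PFun.mem_fix_iff.2 (.inl (Part.mem_map_iff _ |>.2 ⟨_, hm t, rfl⟩))
    | inr s' =>
      obtain ⟨n', h', hI⟩ := ha
      obtain rfl : n = n' := by omega
      obtain ⟨b, d, hd, hb, hm'⟩ := ih hI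
      refine ⟨b, c + d, by nlinarith, hb, fun t => ?_⟩
      refine PFun.mem_fix_iff.2 (.inr ⟨(s', t + c), Part.mem_map_iff _ |>.2 ⟨_, hm t, rfl⟩, ?_⟩)
      rw [← add_assoc]
      exact hm' (t + c)

end Spec

/-! ### Procedures on simple elements -/

/-- The basic operations realize a Garside structure on a nontrivial group, at positive cost. -/
structure BasicOps.Models {S : Type} {lam : ℕ} (O : BasicOps S lam) {G : Type*} [Group G]
    (g : GarsideStructure G) (atom : Fin lam → G) (val : S → G) : Prop
    extends O.Realizes g atom val where
  range_atom : Set.range atom = {a : G | g.IsAtom a}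
  one_le_cost : 1 ≤ O.cost
  delta_ne_one : g.delta ≠ 1

/-- The cost of one basic operation for each atom. -/
def BasicOps.sweep {S : Type} {lam : ℕ} (O : BasicOps S lam) : ℕ := O.cost * lam

/-- The unit `C λ ‖Δ‖` in which the costs of procedures on simple elements are measured. -/
noncomputable def BasicOps.unit {S : Type} {lam : ℕ} (O : BasicOps S lam) {G : Type*} [Group G]
    (g : GarsideStructure G) : ℕ := O.cost * lam * g.norm g.delta

open GarsideStructure

variable {S : Type} {lam : ℕ} {O : BasicOps S lam} {G : Type*} [Group G]
  {g : GarsideStructure G} {atom : Fin lam → G} {val : S → G}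

/-- The first atom that divides `x` on the left. -/
noncomputable def firstAtom (g : GarsideStructure G) (atom : Fin lam → G) (x : G) :
    Option (Fin lam) :=
  (List.finRange lam).find? (fun i => @decide (g.Le (atom i) x) (Classical.dec _))

theorem BasicOps.norm_mul_sweep : g.norm g.delta * O.sweep = O.unit g := Nat.mul_comm _ _

namespace BasicOps.Models

variable (H : O.Models g atom val)

include H

theorem isAtom (i : Fin lam) : g.IsAtom (atom i) := by
  have : atom i ∈ Set.range atom := ⟨i, rfl⟩
  rwa [H.range_atom] at this

theorem exists_atom_le {x : G} (hx : x ∈ g.P) (h : x ≠ 1) : ∃ i, g.Le (atom i) x := by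
  obtain ⟨a, ha, hax⟩ := exists_isAtom_le hx h
  have : a ∈ Set.range atom := by rwa [H.range_atom]
  obtain ⟨i, rfl⟩ := this
  exact ⟨i, hax⟩

theorem exists_atom_ge {x : G} (hx : x ∈ g.P) (h : x ≠ 1) : ∃ i, g.Ge x (atom i) := by
  obtain ⟨a, ha, hax⟩ := exists_isAtom_ge hx h
  have : a ∈ Set.range atom := by rwa [H.range_atom]
  obtain ⟨i, rfl⟩ := this
  exact ⟨i, hax⟩

theorem one_le_lam : 1 ≤ lam := by
  obtain ⟨i, -⟩ := H.exists_atom_le g.delta_mem H.delta_ne_one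
  exact Nat.one_le_of_lt i.2

theorem one_le_norm_delta : 1 ≤ g.norm g.delta := one_le_norm g.delta_mem H.delta_ne_one

theorem cost_le_sweep : O.cost ≤ O.sweep := Nat.le_mul_of_pos_right _ H.one_le_lam

theorem lam_le_sweep : lam ≤ O.sweep := Nat.le_mul_of_pos_left _ H.one_le_cost

theorem sweep_le_unit : O.sweep ≤ O.unit g := Nat.le_mul_of_pos_right _ H.one_le_norm_delta

theorem one_le_sweep : 1 ≤ O.sweep := H.one_le_cost.trans H.cost_le_sweep

theorem one_le_unit : 1 ≤ O.unit g := H.one_le_sweep.trans H.sweep_le_unit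

/-- The cost of a loop with at most `‖Δ‖` passes. -/
theorem loop_le {n : ℕ} (hn : n ≤ g.norm g.delta) (k : ℕ) :
    (n + 1) * (k * O.sweep) ≤ 2 * k * O.unit g := by
  have h₁ := H.one_le_norm_delta
  calc (n + 1) * (k * O.sweep) ≤ (2 * g.norm g.delta) * (k * O.sweep) := by gcongr; omega
    _ = 2 * k * O.unit g := by rw [← O.norm_mul_sweep]; ring

theorem mem (s : S) : val s ∈ g.P := (H.isSimple s).mem

theorem norm_le (s : S) : g.norm (val s) ≤ g.norm g.delta := (H.isSimple s).norm_le

theorem norm_lt_of_le {i : Fin lam} {x : G} (h : g.Le (atom i) x) :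
    g.norm ((atom i)⁻¹ * x) + 1 ≤ g.norm x := by
  have h₁ := norm_add_norm_le (H.isAtom i).1 h
  have h₂ := one_le_norm (H.isAtom i).1 (H.isAtom i).2.1
  rw [mul_inv_cancel_left] at h₁
  omega

theorem norm_lt_of_ge {i : Fin lam} {x : G} (h : g.Ge x (atom i)) :
    g.norm (x * (atom i)⁻¹) + 1 ≤ g.norm x := by
  have h₁ := norm_add_norm_le h (H.isAtom i).1
  have h₂ := one_le_norm (H.isAtom i).1 (H.isAtom i).2.1
  rw [inv_mul_cancel_right] at h₁
  omega

/-- The atom found is recorded as the first admissible one, so that it depends on the group element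
only and not on its representation; the spelling of keys needs this. -/
theorem spec_takeLeft_aux (s : S) (l : List (Fin lam)) :
    Spec (takeLeft O s l) (l.length * (O.cost + 1) + 1) fun r =>
      match r with
      | none => ∀ i ∈ l, ¬ g.Le (atom i) (val s)
      | some (i, s') => l.find? (fun i => @decide (g.Le (atom i) (val s)) (Classical.dec _)) =
          some i ∧ g.Le (atom i) (val s) ∧ val s' = (atom i)⁻¹ * val s := by
  classical
  induction l with
  | nil => exact Spec.tick_bind (B := 0) (by simp) (Spec.pure (by simp))
  | cons i l ih =>
    refine Spec.tick_bind (B := (l.length + 1) * (O.cost + 1)) (by simp; omega) ?_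
    refine Spec.bind (B := O.cost) (B' := l.length * (O.cost + 1) + 1)
      (Q := fun r => r = O.leftDiv i s) ?_ (by ring_nf; omega) ?_
    · exact Spec.tick_bind (B := 0) (by simp) (Spec.pure rfl)
    · rintro r rfl
      cases h : O.leftDiv i s with
      | none =>
        have hn := H.leftDiv_none i s h
        refine ih.mono le_rfl ?_
        rintro (_ | ⟨j, s'⟩) hr
        · simpa [hn] using hr
        · simpa [hn] using hr
      | some s' =>
        have hn := H.leftDiv_some i s s' h
        exact Spec.pure ⟨by simp [hn.1], hn⟩

theorem length_finRange_mul_le : (List.finRange lam).length * (O.cost + 1) + 1 ≤ 3 * O.sweep := by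
  have h₁ := H.one_le_sweep
  have h₂ := H.lam_le_sweep
  rw [List.length_finRange, mul_add, mul_one, mul_comm lam]
  simp only [sweep] at *
  omega

theorem spec_takeLeft (s : S) :
    Spec (takeLeft O s (List.finRange lam)) (3 * O.sweep) fun r =>
      match r with
      | none => val s = 1
      | some (i, s') => firstAtom g atom (val s) = some i ∧ val s ≠ 1 ∧
          g.Le (atom i) (val s) ∧ val s' = (atom i)⁻¹ * val s := by
  refine (H.spec_takeLeft_aux s _).mono H.length_finRange_mul_le ?_
  rintro (_ | ⟨i, s'⟩) h
  · by_contra h₁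
    obtain ⟨i, hi⟩ := H.exists_atom_le (H.mem s) h₁
    exact h i (by simp) hi
  · refine ⟨h.1, fun h₁ => ?_, h.2⟩
    have := h.2.1
    rw [h₁] at this
    exact (H.isAtom i).2.1 (eq_one_of_le_one (H.isAtom i).1 this)

theorem spec_takeRight_aux (s : S) (l : List (Fin lam)) :
    Spec (takeRight O s l) (l.length * (O.cost + 1) + 1) fun r =>
      match r with
      | none => ∀ i ∈ l, ¬ g.Ge (val s) (atom i)
      | some (i, s') => g.Ge (val s) (atom i) ∧ val s' = val s * (atom i)⁻¹ := by
  induction l with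
  | nil => exact Spec.tick_bind (B := 0) (by simp) (Spec.pure (by simp))
  | cons i l ih =>
    refine Spec.tick_bind (B := (l.length + 1) * (O.cost + 1)) (by simp; omega) ?_
    refine Spec.bind (B := O.cost) (B' := l.length * (O.cost + 1) + 1)
      (Q := fun r => r = O.rightDiv i s) ?_ (by ring_nf; omega) ?_
    · exact Spec.tick_bind (B := 0) (by simp) (Spec.pure rfl)
    · rintro r rfl
      cases h : O.rightDiv i s with
      | none =>
        have hn := H.rightDiv_none i s h
        refine ih.mono le_rfl ?_
        rintro (_ | ⟨j, s'⟩) hr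
        · simpa [hn] using hr
        · exact hr
      | some s' => exact Spec.pure (H.rightDiv_some i s s' h)

theorem spec_takeRight (s : S) :
    Spec (takeRight O s (List.finRange lam)) (3 * O.sweep) fun r =>
      match r with
      | none => val s = 1
      | some (i, s') => g.Ge (val s) (atom i) ∧ val s' = val s * (atom i)⁻¹ := by
  refine (H.spec_takeRight_aux s _).mono H.length_finRange_mul_le ?_
  rintro (_ | ⟨i, s'⟩) h
  · by_contra h₁
    obtain ⟨i, hi⟩ := H.exists_atom_ge (H.mem s) h₁
    exact h i (by simp) hi
  · exact h

theorem spec_takeCommon_aux (s t : S) (l : List (Fin lam)) :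
    Spec (takeCommon O s t l) (l.length * (2 * O.cost + 1) + 1) fun r =>
      match r with
      | none => ∀ i ∈ l, g.Le (atom i) (val s) → ¬ g.Le (atom i) (val t)
      | some (i, s', t') => g.Le (atom i) (val s) ∧ g.Le (atom i) (val t) ∧
          val s' = (atom i)⁻¹ * val s ∧ val t' = (atom i)⁻¹ * val t := by
  induction l with
  | nil => exact Spec.tick_bind (B := 0) (by simp) (Spec.pure (by simp))
  | cons i l ih =>
    refine Spec.tick_bind (B := (l.length + 1) * (2 * O.cost + 1)) (by simp; omega) ?_
    refine Spec.bind (B := O.cost) (B' := l.length * (2 * O.cost + 1) + O.cost + 1)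
      (Q := fun r => r = O.leftDiv i s) ?_ (by ring_nf; omega) ?_
    · exact Spec.tick_bind (B := 0) (by simp) (Spec.pure rfl)
    · rintro r rfl
      cases h : O.leftDiv i s with
      | none =>
        have hn := H.leftDiv_none i s h
        refine ih.mono (by omega) ?_
        rintro (_ | ⟨j, s', t'⟩) hr
        · simpa [hn] using hr
        · exact hr
      | some s' =>
        refine Spec.bind (B := O.cost) (B' := l.length * (2 * O.cost + 1) + 1)
          (Q := fun r => r = O.leftDiv i t) ?_ (by omega) ?_
        · exact Spec.tick_bind (B := 0) (by simp) (Spec.pure rfl)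
        rintro r rfl
        cases h' : O.leftDiv i t with
        | none =>
          have hn := H.leftDiv_none i t h'
          refine ih.mono (by omega) ?_
          rintro (_ | ⟨j, s', t'⟩) hr
          · simpa [hn] using hr
          · exact hr
        | some t' =>
          have h₁ := H.leftDiv_some i s s' h
          have h₂ := H.leftDiv_some i t t' h'
          exact Spec.pure ⟨h₁.1, h₂.1, h₁.2, h₂.2⟩

theorem spec_takeCommon (s t : S) :
    Spec (takeCommon O s t (List.finRange lam)) (4 * O.sweep) fun r =>
      match r with
      | none => ∀ e ∈ g.P, g.Le e (val s) → g.Le e (val t) → e = 1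
      | some (i, s', t') => g.Le (atom i) (val s) ∧ g.Le (atom i) (val t) ∧
          val s' = (atom i)⁻¹ * val s ∧ val t' = (atom i)⁻¹ * val t := by
  refine (H.spec_takeCommon_aux s t _).mono ?_ ?_
  · have h₁ := H.one_le_sweep
    have h₂ := H.lam_le_sweep
    simp only [List.length_finRange, mul_add, mul_one, sweep] at *
    rw [mul_left_comm, mul_comm lam]
    omega
  · rintro (_ | ⟨i, s', t'⟩) h
    · intro e he h₁ h₂
      by_contra hne
      obtain ⟨i, hi⟩ := H.exists_atom_le he hne
      exact h i (by simp) (hi.trans h₁) (hi.trans h₂)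
    · exact h

theorem spec_tryLeft {i : Fin lam} {d : S} (h : g.Le (atom i) (val d)) :
    Spec (tryLeft O i d) O.sweep fun r => ∃ d', r = some d' ∧ val d' = (atom i)⁻¹ * val d := by
  refine Spec.tick_bind (B := 0) H.cost_le_sweep (Spec.pure ?_)
  cases hd : O.leftDiv i d with
  | none => exact absurd h (H.leftDiv_none i d hd)
  | some d' => exact ⟨d', rfl, (H.leftDiv_some i d d' hd).2⟩

theorem spec_tryRight {i : Fin lam} {d : S} (h : g.Ge (val d) (atom i)) :
    Spec (tryRight O i d) O.sweep fun r => ∃ d', r = some d' ∧ val d' = val d * (atom i)⁻¹ := by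
  refine Spec.tick_bind (B := 0) H.cost_le_sweep (Spec.pure ?_)
  cases hd : O.rightDiv i d with
  | none => exact absurd h (H.rightDiv_none i d hd)
  | some d' => exact ⟨d', rfl, (H.rightDiv_some i d d' hd).2⟩

theorem spec_isOne (s : S) :
    Spec (isOne O s) (4 * O.unit g) fun b => b = true ↔ val s = 1 := by
  have h₁ := H.one_le_unit
  have h₂ := H.sweep_le_unit
  refine Spec.tick_bind (B := 3 * O.sweep) (by omega) ?_
  refine Spec.bind (B' := 0) (H.spec_takeLeft s) (by simp) ?_
  rintro (_ | ⟨i, s'⟩) h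
  · exact Spec.pure (by simpa using h)
  · exact Spec.pure (by simpa using h.2.1)

/-- The quotient s⁻¹d is invariant, and s ≼ d ensures that every atom taken from s can be taken from
d, so the failing branch is never reached. The norm of s bounds the passes. -/
theorem spec_rightCompl (s : S) :
    Spec (rightCompl O s) (11 * O.unit g) fun r => val r = (val s)⁻¹ * g.delta := by
  have h₁ := H.one_le_unit
  have h₂ := H.one_le_sweep
  refine Spec.tick_bind (B := 10 * O.unit g) (by omega) ?_
  refine (Spec.loop (fun q n => g.norm (val q.2) ≤ n ∧ g.Le (val q.2) (val q.1) ∧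
    (val q.2)⁻¹ * val q.1 = (val s)⁻¹ * g.delta) (B := 5 * O.sweep) ?_
    ⟨H.norm_le s, H.delta ▸ (H.isSimple s).2, by rw [H.delta]⟩).mono
      (H.loop_le le_rfl 5) fun _ h => h
  rintro ⟨d, s⟩ n ⟨hn, hle, heq⟩
  dsimp only at hn hle heq
  refine Spec.tick_bind (B := 4 * O.sweep) (by omega) ?_
  refine Spec.bind (B' := O.sweep) (H.spec_takeLeft s) (by omega) ?_
  rintro (_ | ⟨i, s'⟩) h
  · change val s = 1 at h
    exact Spec.pure (by simpa [h] using heq)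
  · obtain ⟨-, -, hi, hs'⟩ := h
    refine Spec.bind (B' := 0) (H.spec_tryLeft (hi.trans hle)) (by omega) ?_
    rintro _ ⟨d', rfl, hd'⟩
    refine Spec.pure ⟨n - 1, ?_, ?_, ?_, ?_⟩
    · have := H.norm_lt_of_le hi; omega
    · have := H.norm_lt_of_le hi; dsimp only; rw [hs']; omega
    · simpa only [hs', hd', mul_le_mul_left_iff] using hle
    · simpa [hs', hd', mul_assoc] using heq

theorem spec_leftCompl (s : S) :
    Spec (leftCompl O s) (11 * O.unit g) fun r => val r = g.delta * (val s)⁻¹ := by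
  have h₁ := H.one_le_unit
  have h₂ := H.one_le_sweep
  refine Spec.tick_bind (B := 10 * O.unit g) (by omega) ?_
  refine (Spec.loop (fun q n => g.norm (val q.2) ≤ n ∧ g.Ge (val q.1) (val q.2) ∧
    val q.1 * (val q.2)⁻¹ = g.delta * (val s)⁻¹) (B := 5 * O.sweep) ?_
    ⟨H.norm_le s, H.delta ▸ (H.isSimple s).leftCompl.mem, by rw [H.delta]⟩).mono
      (H.loop_le le_rfl 5) fun _ h => h
  rintro ⟨d, s⟩ n ⟨hn, hle, heq⟩
  dsimp only at hn hle heq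
  refine Spec.tick_bind (B := 4 * O.sweep) (by omega) ?_
  refine Spec.bind (B' := O.sweep) (H.spec_takeRight s) (by omega) ?_
  rintro (_ | ⟨i, s'⟩) h
  · change val s = 1 at h
    exact Spec.pure (by simpa [h] using heq)
  · obtain ⟨hi, hs'⟩ := h
    have hdi : g.Ge (val d) (atom i) := by
      have := g.P.mul_mem hle hi
      simpa [Ge, mul_assoc] using this
    refine Spec.bind (B' := 0) (H.spec_tryRight hdi) (by omega) ?_
    rintro _ ⟨d', rfl, hd'⟩
    refine Spec.pure ⟨n - 1, ?_, ?_, ?_, ?_⟩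
    · have := H.norm_lt_of_ge hi; omega
    · have := H.norm_lt_of_ge hi; dsimp only; rw [hs']; omega
    · simpa [Ge, hs', hd', mul_assoc] using hle
    · simpa [hs', hd', mul_assoc] using heq

theorem spec_isDelta (s : S) :
    Spec (isDelta O s) (16 * O.unit g) fun b => b = true ↔ val s = g.delta := by
  have h₁ := H.one_le_unit
  refine Spec.tick_bind (B := 15 * O.unit g) (by omega) ?_
  refine Spec.bind (B' := 4 * O.unit g) (H.spec_rightCompl s) (by omega) fun r hr => ?_
  refine (H.spec_isOne r).mono le_rfl fun b hb => ?_
  rw [hb, hr, inv_mul_eq_one]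

theorem spec_tau (s : S) :
    Spec (tau O s) (23 * O.unit g) fun r => val r = g.delta⁻¹ * val s * g.delta := by
  have h₁ := H.one_le_unit
  refine Spec.tick_bind (B := 22 * O.unit g) (by omega) ?_
  refine Spec.bind (B' := 11 * O.unit g) (H.spec_rightCompl s) (by omega) fun r hr => ?_
  refine (H.spec_rightCompl r).mono le_rfl fun b hb => ?_
  simp [hb, hr]

theorem spec_tauInv (s : S) :
    Spec (tauInv O s) (23 * O.unit g) fun r => val r = g.delta * val s * g.delta⁻¹ := by
  have h₁ := H.one_le_unit
  refine Spec.tick_bind (B := 22 * O.unit g) (by omega) ?_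
  refine Spec.bind (B' := 11 * O.unit g) (H.spec_leftCompl s) (by omega) fun r hr => ?_
  refine (H.spec_leftCompl r).mono le_rfl fun b hb => ?_
  simp [hb, hr, mul_assoc]

theorem spec_tauIter (n : ℕ) (s : S) :
    Spec (tauIter O n s) ((n + 1) * (24 * O.unit g)) fun r =>
      val r = (g.delta ^ n)⁻¹ * val s * g.delta ^ n := by
  have h₁ := H.one_le_unit
  induction n generalizing s with
  | zero => exact Spec.tick_bind (B := 0) (by omega) (Spec.pure (by simp))
  | succ n ih =>
    have e : (n + 1 + 1) * (24 * O.unit g) = (n + 1) * (24 * O.unit g) + 24 * O.unit g := by ring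
    refine Spec.tick_bind (B := (n + 1) * (24 * O.unit g) + 23 * O.unit g) (by omega) ?_
    refine Spec.bind (B' := (n + 1) * (24 * O.unit g)) (H.spec_tau s) (by omega) fun r hr => ?_
    refine (ih r).mono le_rfl fun b hb => ?_
    simp [hb, hr, pow_succ', mul_assoc]

theorem spec_tauInvIter (n : ℕ) (s : S) :
    Spec (tauInvIter O n s) ((n + 1) * (24 * O.unit g)) fun r =>
      val r = g.delta ^ n * val s * (g.delta ^ n)⁻¹ := by
  have h₁ := H.one_le_unit
  induction n generalizing s with
  | zero => exact Spec.tick_bind (B := 0) (by omega) (Spec.pure (by simp))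
  | succ n ih =>
    have e : (n + 1 + 1) * (24 * O.unit g) = (n + 1) * (24 * O.unit g) + 24 * O.unit g := by ring
    refine Spec.tick_bind (B := (n + 1) * (24 * O.unit g) + 23 * O.unit g) (by omega) ?_
    refine Spec.bind (B' := (n + 1) * (24 * O.unit g)) (H.spec_tauInv s) (by omega) fun r hr => ?_
    refine (ih r).mono le_rfl fun b hb => ?_
    simp [hb, hr, pow_succ, mul_assoc]

theorem spec_tauPow (p : ℤ) (s : S) :
    Spec (tauPow O p s) ((p.natAbs + 2) * (24 * O.unit g)) fun r =>
      val r = (g.delta ^ p)⁻¹ * val s * g.delta ^ p := by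
  have h₁ := H.one_le_unit
  have e : (p.natAbs + 2) * (24 * O.unit g) =
    (p.natAbs + 1) * (24 * O.unit g) + 24 * O.unit g := by ring
  refine Spec.tick_bind (B := (p.natAbs + 1) * (24 * O.unit g)) (by omega) ?_
  split_ifs with hp
  · refine (H.spec_tauIter _ s).mono le_rfl fun r hr => ?_
    rw [hr, ← zpow_natCast, Int.natAbs_of_nonneg hp]
  · refine (H.spec_tauInvIter _ s).mono le_rfl fun r hr => ?_
    have : ((p.natAbs : ℕ) : ℤ) = -p := by omega
    rw [hr, ← zpow_natCast, this]
    simp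

theorem spec_stripCommon (s t : S) :
    Spec (stripCommon O s t) (10 * O.unit g) fun r => ∃ u ∈ g.P, val s = u * val r.1 ∧
      val t = u * val r.2 ∧ ∀ e ∈ g.P, g.Le e (val r.1) → g.Le e (val r.2) → e = 1 := by
  have h₂ := H.one_le_sweep
  refine (Spec.loop (fun q n => g.norm (val q.2) ≤ n ∧
    ∃ u ∈ g.P, val s = u * val q.1 ∧ val t = u * val q.2) (B := 5 * O.sweep) ?_
    ⟨H.norm_le t, 1, g.P.one_mem, by simp⟩).mono (H.loop_le le_rfl 5) fun _ h => h
  rintro ⟨s', t'⟩ n ⟨hn, u, hu, hs, ht⟩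
  dsimp only at hn hs ht
  refine Spec.tick_bind (B := 4 * O.sweep) (by omega) ?_
  refine Spec.bind (B' := 0) (H.spec_takeCommon s' t') (by omega) ?_
  rintro (_ | ⟨i, s'', t''⟩) h
  · exact Spec.pure ⟨u, hu, hs, ht, h⟩
  · obtain ⟨h₁, h₂, h₃, h₄⟩ := h
    have := H.norm_lt_of_le h₂
    refine Spec.pure ⟨n - 1, ?_, ?_, u * atom i, g.P.mul_mem hu (H.isAtom i).1, ?_, ?_⟩
    · omega
    · dsimp only; rw [h₄]; omega
    · simpa [h₃, mul_assoc] using hs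
    · simpa [h₄, mul_assoc] using ht

/-- The basic operations only divide, so the common prefix u cannot be accumulated directly. It is
recorded through d = u⁻¹Δ, from which a left complement recovers it. -/
theorem spec_gcdLoop (s t : S) :
    Spec (gcdLoop O O.delta s t) (12 * O.unit g) fun r =>
      val r = (g.gcd (val s) (val t))⁻¹ * g.delta := by
  have h₂ := H.one_le_sweep
  refine (Spec.loop (fun q n => g.norm (val q.2.2) ≤ n ∧
    ∃ u ∈ g.P, val s = u * val q.2.1 ∧ val t = u * val q.2.2 ∧ g.delta = u * val q.1)
    (B := 6 * O.sweep) ?_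
    ⟨H.norm_le t, 1, g.P.one_mem, by simp [H.delta]⟩).mono (H.loop_le le_rfl 6) fun _ h => h
  rintro ⟨d, s', t'⟩ n ⟨hn, u, hu, hs, ht, hd⟩
  refine Spec.tick_bind (B := 5 * O.sweep) (by omega) ?_
  refine Spec.bind (B' := O.sweep) (H.spec_takeCommon s' t') (by omega) ?_
  simp only at hs ht hd hn
  rintro (_ | ⟨i, s'', t''⟩) h
  · refine Spec.pure ?_
    simp only [Sum.elim_inl]
    rw [hs, ht, gcd_mul_eq (H.mem s') (H.mem t') h, hd, inv_mul_cancel_left]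
  · obtain ⟨h₁, h₂, h₃, h₄⟩ := h
    -- As t = ut' divides Δ = ud, the remainder t' divides d.
    have hid : g.Le (atom i) (val d) := by
      have h₅ := (H.isSimple t).2
      rw [ht, hd, mul_le_mul_left_iff] at h₅
      exact h₂.trans h₅
    refine Spec.bind (B' := 0) (H.spec_tryLeft hid) (by omega) ?_
    rintro _ ⟨d', rfl, hd'⟩
    have := H.norm_lt_of_le h₂
    refine Spec.pure ⟨n - 1, ?_, ?_, u * atom i, g.P.mul_mem hu (H.isAtom i).1, ?_, ?_, ?_⟩
    · omega
    · dsimp only; rw [h₄]; omega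
    · simpa [h₃, mul_assoc] using hs
    · simpa [h₄, mul_assoc] using ht
    · simpa [hd', mul_assoc] using hd

theorem spec_simpleGcd (s t : S) :
    Spec (simpleGcd O s t) (24 * O.unit g) fun r => val r = g.gcd (val s) (val t) := by
  have h₁ := H.one_le_unit
  refine Spec.tick_bind (B := 23 * O.unit g) (by omega) ?_
  refine Spec.bind (B' := 11 * O.unit g) (H.spec_gcdLoop s t) (by omega) fun r hr => ?_
  refine (H.spec_leftCompl r).mono le_rfl fun b hb => ?_
  simp [hb, hr]

theorem spec_simpleEq (s t : S) :
    Spec (simpleEq O s t) (20 * O.unit g) fun b => b = true ↔ val s = val t := by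
  have h₁ := H.one_le_unit
  refine Spec.tick_bind (B := 19 * O.unit g) (by omega) ?_
  refine Spec.bind (B' := 9 * O.unit g) (H.spec_stripCommon s t) (by omega) ?_
  rintro ⟨s', t'⟩ ⟨u, hu, hs, ht, hc⟩
  simp only at hs ht hc
  refine Spec.bind (B' := 5 * O.unit g) (H.spec_isOne s') (by omega) fun b hb => ?_
  split_ifs with hb'
  · refine (H.spec_isOne t').mono (by omega) fun b' hb'' => ?_
    rw [hb'', hs, ht, hb.1 hb', mul_right_inj, eq_comm]
  · refine Spec.pure ?_
    simp only [Bool.false_eq_true, false_iff, hs, ht, mul_right_inj]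
    intro h
    -- The remainders are coprime, so if they are equal they are trivial.
    exact hb' (hb.2 (hc _ (H.mem s') (le_refl _) (h ▸ le_refl _)))

theorem spec_localSliding (s t : S) :
    Spec (localSliding O s t) (33 * O.unit g) fun r =>
      g.IsSliding (val s) (val t) (val r.1) (val r.2) := by
  have h₁ := H.one_le_unit
  refine Spec.tick_bind (B := 32 * O.unit g) (by omega) ?_
  refine Spec.bind (B' := 21 * O.unit g) (H.spec_rightCompl s) (by omega) fun s₁ hs₁ => ?_
  refine Spec.bind (B' := 11 * O.unit g) (H.spec_stripCommon s₁ t) (by omega) ?_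
  rintro ⟨s', t'⟩ ⟨u, hu, hs, ht, hc⟩
  refine Spec.bind (B' := 0) (H.spec_leftCompl s') (by omega) fun r hr => ?_
  refine Spec.pure ?_
  simp only at hs ht hc
  -- From ∂(s) = us' follows su = Δs'⁻¹, so ∂(su) = s', which is coprime to t'.
  have hru : val r = val s * u := by
    rw [hr, mul_inv_eq_iff_eq_mul, mul_assoc, ← hs, hs₁, mul_inv_cancel_left]
  refine ⟨H.isSimple _, H.isSimple _, ?_, ?_, ?_⟩
  · rw [hru, ht, mul_assoc]
  · rw [hru]; exact le_mul_right _ hu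
  · intro e he h₁ h₂
    refine hc e he ?_ h₂
    rw [hr] at h₁
    simpa using h₁

end BasicOps.Models

theorem list_prod_map_conj (c : G) (l : List G) :
    (l.map fun s => c⁻¹ * s * c).prod = c⁻¹ * l.prod * c := by
  induction l with
  | nil => simp
  | cons x l ih => rw [List.map_cons, List.prod_cons, ih, List.prod_cons]; group

theorem spec_lastFactor (x : S) (l : List S) :
    Spec (lastFactor x l) (l.length + 1) fun r => r = (x :: l).getLast (by simp) := by
  induction l generalizing x with
  | nil => exact Spec.tick_bind (B := 0) (by simp) (Spec.pure (by simp))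
  | cons y l ih =>
    refine Spec.tick_bind (B := l.length + 1) (by simp; omega) ?_
    exact (ih y).mono le_rfl fun r hr => by simpa using hr

/-! ### Procedures on left normal forms -/

/-- The data `x` are those of a left normal form. -/
def NF.IsNormal (g : GarsideStructure G) (val : S → G) (x : NF S) : Prop :=
  g.IsNormal (x.factors.map val)

theorem NF.IsNormal.eq_of_toGroup_eq [Nontrivial G] {x y : NF S} (hx : x.IsNormal g val)
    (hy : y.IsNormal g val) (h : x.toGroup g val = y.toGroup g val) :
    x.pow = y.pow ∧ x.factors.map val = y.factors.map val :=
  GarsideStructure.IsNormal.eq_of_eq hx hy h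

namespace BasicOps.Models

variable (H : O.Models g atom val)

include H

theorem nontrivial : Nontrivial G := ⟨g.delta, 1, H.delta_ne_one⟩

theorem isSimple_map (l : List S) : ∀ t ∈ l.map val, g.IsSimple t := by
  simp only [List.mem_map]
  rintro _ ⟨s, -, rfl⟩
  exact H.isSimple s

theorem spec_insertRight (l : List S) (s : S) :
    Spec (insertRight O l s) ((l.length + 1) * (34 * O.unit g)) fun r =>
      g.InsRight (l.map val) (val s) (val r.1) (r.2.map val) := by
  have h₁ := H.one_le_unit
  induction l with
  | nil => exact Spec.tick_bind (B := 0) (by simp; omega) (Spec.pure (.nil _))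
  | cons x l ih =>
    have e : ((x :: l).length + 1) * (34 * O.unit g) =
      (l.length + 1) * (34 * O.unit g) + 34 * O.unit g := by rw [List.length_cons]; ring
    refine Spec.tick_bind (B := (l.length + 1) * (34 * O.unit g) + 33 * O.unit g) (by omega) ?_
    refine Spec.bind (B' := 33 * O.unit g) ih (by omega) ?_
    rintro ⟨y, ys⟩ h
    refine Spec.bind (B' := 0) (H.spec_localSliding x y) (by omega) ?_
    rintro ⟨x', y'⟩ h'
    exact Spec.pure (.cons h h')

theorem spec_insertLeft (l : List S) (s : S) :
    Spec (insertLeft O s l) ((l.length + 1) * (34 * O.unit g)) fun r =>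
      g.InsLeft (val s) (l.map val) (val r.1) (r.2.map val) := by
  have h₁ := H.one_le_unit
  induction l generalizing s with
  | nil => exact Spec.tick_bind (B := 0) (by simp; omega) (Spec.pure (.nil _))
  | cons x l ih =>
    have e : ((x :: l).length + 1) * (34 * O.unit g) =
      (l.length + 1) * (34 * O.unit g) + 34 * O.unit g := by rw [List.length_cons]; ring
    refine Spec.tick_bind (B := (l.length + 1) * (34 * O.unit g) + 33 * O.unit g) (by omega) ?_
    refine Spec.bind (B' := (l.length + 1) * (34 * O.unit g)) (H.spec_localSliding s x)
      (by omega) ?_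
    rintro ⟨s', x'⟩ h
    refine Spec.bind (B' := 0) (ih x') (by omega) ?_
    rintro ⟨y, ys⟩ h'
    exact Spec.pure (.cons h h')

theorem spec_dropLastOne_aux (l : List S) :
    Spec (dropLastOne O l) ((l.length + 1) * (5 * O.unit g)) fun r =>
      (r = l ∧ ∀ t ∈ (l.map val).getLast?, t ≠ 1) ∨
        (r = l.dropLast ∧ (l.map val).getLast? = some 1) := by
  have h₁ := H.one_le_unit
  induction l with
  | nil => exact Spec.tick_bind (B := 0) (by simp; omega) (Spec.pure (by simp))
  | cons x l ih =>
    have e : ((x :: l).length + 1) * (5 * O.unit g) =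
      (l.length + 1) * (5 * O.unit g) + 5 * O.unit g := by rw [List.length_cons]; ring
    cases l with
    | nil =>
      refine Spec.tick_bind (B := 10 * O.unit g - 1) (by simp; omega) ?_
      change Spec (isOne O x >>= fun b => if b = true then pure [] else pure [x]) _ _
      refine Spec.bind (B' := 0) (H.spec_isOne x) (by omega) fun b hb => ?_
      split_ifs with hb'
      · exact Spec.pure (.inr ⟨rfl, by simpa using hb.1 hb'⟩)
      · exact Spec.pure (.inl ⟨rfl, by simpa [← hb] using hb'⟩)
    | cons y l =>
      refine Spec.tick_bind (B := ((y :: l).length + 1) * (5 * O.unit g)) (by omega) ?_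
      change Spec (dropLastOne O (y :: l) >>= fun r => pure (x :: r)) _ _
      refine Spec.bind (B' := 0) ih (by omega) ?_
      rintro r (⟨rfl, h⟩ | ⟨rfl, h⟩)
      · exact Spec.pure (.inl ⟨rfl, by simpa [List.getLast?_cons_cons] using h⟩)
      · exact Spec.pure (.inr ⟨rfl, by simpa [List.getLast?_cons_cons] using h⟩)

theorem spec_dropLastOne {l : List S} (hc : (l.map val).IsChain g.LeftWeighted)
    (h₁ : ∀ t ∈ (l.map val).dropLast, t ≠ 1) (hd : ∀ t ∈ l.map val, t ≠ g.delta) :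
    Spec (dropLastOne O l) ((l.length + 1) * (5 * O.unit g)) fun r =>
      g.IsNormal (r.map val) ∧ (r.map val).prod = (l.map val).prod ∧ r.length ≤ l.length := by
  refine (H.spec_dropLastOne_aux l).mono le_rfl ?_
  rintro r (⟨rfl, h⟩ | ⟨rfl, h⟩)
  · exact ⟨isNormal_of_getLast (H.isSimple_map r) hc h₁ hd h, rfl, le_rfl⟩
  · rw [List.map_dropLast]
    refine ⟨isNormal_dropLast (H.isSimple_map l) hc h₁ hd, ?_, by simp⟩
    conv_rhs => rw [← List.dropLast_append_getLast? 1 h]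
    simp

theorem spec_cleanUp (p : ℤ) {y : S} {ys : List S}
    (h : g.IsAlmostNormal (val y) (ys.map val)) :
    Spec (cleanUp O p y ys) ((ys.length + 6) * (5 * O.unit g)) fun r =>
      r.IsNormal g val ∧ r.toGroup g val = g.delta ^ p * (val y * (ys.map val).prod) ∧
        r.factors.length ≤ ys.length + 1 := by
  have h₁ := H.one_le_unit
  have e : (ys.length + 6) * (5 * O.unit g) =
    ((y :: ys).length + 1) * (5 * O.unit g) + 20 * O.unit g := by rw [List.length_cons]; ring
  have e' : ((y :: ys).length + 1) * (5 * O.unit g) =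
    (ys.length + 1) * (5 * O.unit g) + 5 * O.unit g := by rw [List.length_cons]; ring
  refine Spec.tick_bind (B := ((y :: ys).length + 1) * (5 * O.unit g) + 16 * O.unit g)
    (by omega) ?_
  refine Spec.bind (B' := ((y :: ys).length + 1) * (5 * O.unit g)) (H.spec_isDelta y)
    (by omega) fun b hb => ?_
  split_ifs with hb'
  · refine Spec.bind (B' := 0) (H.spec_dropLastOne h.isChain.of_cons ?_ h.ne_delta)
      (by omega) ?_
    · intro t ht
      refine h.ne_one t ?_
      cases ys with
      | nil => simp at ht
      | cons z zs => exact List.mem_cons_of_mem _ ht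
    · rintro r ⟨hr₁, hr₂, hr₃⟩
      refine Spec.pure ⟨hr₁, ?_, by dsimp only; omega⟩
      simp only [NF.toGroup, hr₂, hb.1 hb', zpow_add_one, mul_assoc]
  · refine Spec.bind (B' := 0) (H.spec_dropLastOne (l := y :: ys) h.isChain h.ne_one ?_)
      (by omega) ?_
    · intro t ht
      rcases List.mem_cons.1 ht with rfl | ht
      · exact fun h => hb' (hb.2 h)
      · exact h.ne_delta t ht
    · rintro r ⟨hr₁, hr₂, hr₃⟩
      refine Spec.pure ⟨hr₁, ?_, by simpa using hr₃⟩
      simp only [NF.toGroup, hr₂, List.map_cons, List.prod_cons]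

theorem spec_tauInvAll (l : List S) :
    Spec (tauInvAll O l) ((l.length + 1) * (24 * O.unit g)) fun r =>
      r.map val = (l.map val).map fun s => (g.delta ^ (-1 : ℤ))⁻¹ * s * g.delta ^ (-1 : ℤ) := by
  have h₁ := H.one_le_unit
  induction l with
  | nil => exact Spec.tick_bind (B := 0) (by simp; omega) (Spec.pure (by simp))
  | cons x l ih =>
    have e : ((x :: l).length + 1) * (24 * O.unit g) =
      (l.length + 1) * (24 * O.unit g) + 24 * O.unit g := by rw [List.length_cons]; ring
    refine Spec.tick_bind (B := (l.length + 1) * (24 * O.unit g) + 23 * O.unit g) (by omega) ?_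
    refine Spec.bind (B' := (l.length + 1) * (24 * O.unit g)) (H.spec_tauInv x) (by omega) ?_
    intro x' hx'
    refine Spec.bind (B' := 0) ih (by omega) fun r hr => ?_
    exact Spec.pure (by simp [hr, hx'])

theorem spec_mulRight {x : NF S} (hx : x.IsNormal g val) (s : S) :
    Spec (mulRight O x s) ((x.factors.length + 2) * (39 * O.unit g)) fun r =>
      r.IsNormal g val ∧ r.toGroup g val = x.toGroup g val * val s ∧
        r.factors.length ≤ x.factors.length + 1 := by
  have h₁ := H.one_le_unit
  refine Spec.tick_bind (B := (x.factors.length + 1) * (34 * O.unit g) +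
    (x.factors.length + 6) * (5 * O.unit g)) (by ring_nf; omega) ?_
  refine Spec.bind (B' := (x.factors.length + 6) * (5 * O.unit g))
    (H.spec_insertRight x.factors s) le_rfl ?_
  rintro ⟨y, ys⟩ h
  have hlen : ys.length = x.factors.length := by simpa using h.length_eq
  refine (H.spec_cleanUp x.pow (h.isAlmostNormal hx (H.isSimple s))).mono (by rw [hlen]) ?_
  rintro r ⟨hr₁, hr₂, hr₃⟩
  refine ⟨hr₁, ?_, by simpa [hlen] using hr₃⟩
  rw [hr₂, h.prod_eq, NF.toGroup, mul_assoc]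

theorem spec_mulRightInv {x : NF S} (hx : x.IsNormal g val) (s : S) :
    Spec (mulRightInv O x s) ((x.factors.length + 2) * (64 * O.unit g)) fun r =>
      r.IsNormal g val ∧ r.toGroup g val = x.toGroup g val * (val s)⁻¹ ∧
        r.factors.length ≤ x.factors.length + 1 := by
  have h₁ := H.one_le_unit
  refine Spec.tick_bind (B := (x.factors.length + 1) * (24 * O.unit g) + 11 * O.unit g +
    (x.factors.length + 1) * (34 * O.unit g) + (x.factors.length + 6) * (5 * O.unit g))
    (by ring_nf; omega) ?_
  refine Spec.bind (B' := 11 * O.unit g +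
    (x.factors.length + 1) * (34 * O.unit g) + (x.factors.length + 6) * (5 * O.unit g))
    (H.spec_tauInvAll x.factors) (by omega) fun l hl => ?_
  have hlen₁ : l.length = x.factors.length := by simpa using congrArg List.length hl
  refine Spec.bind (B' :=
    (x.factors.length + 1) * (34 * O.unit g) + (x.factors.length + 6) * (5 * O.unit g))
    (H.spec_leftCompl s) (by omega) fun s' hs' => ?_
  refine Spec.bind (B' := (x.factors.length + 6) * (5 * O.unit g))
    (H.spec_insertRight l s') (by rw [hlen₁]) ?_
  rintro ⟨y, ys⟩ h
  have hlen : ys.length = x.factors.length := by simpa [hlen₁] using h.length_eq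
  have hln : g.IsNormal (l.map val) := by
    rw [hl]
    exact GarsideStructure.IsNormal.conj_delta hx (-1)
  refine (H.spec_cleanUp (x.pow - 1) (h.isAlmostNormal hln (H.isSimple s'))).mono
    (by rw [hlen]) ?_
  rintro r ⟨hr₁, hr₂, hr₃⟩
  refine ⟨hr₁, ?_, by simpa [hlen] using hr₃⟩
  rw [hr₂, h.prod_eq, hl, list_prod_map_conj, hs', NF.toGroup]
  simp [zpow_sub_one, mul_assoc]

theorem spec_mulLeftInv (s : S) {x : NF S} (hx : x.IsNormal g val) :
    Spec (mulLeftInv O s x) ((x.pow.natAbs + x.factors.length + 4) * (39 * O.unit g)) fun r =>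
      r.IsNormal g val ∧ r.toGroup g val = (val s)⁻¹ * x.toGroup g val ∧
        r.factors.length ≤ x.factors.length + 1 := by
  have h₁ := H.one_le_unit
  refine Spec.tick_bind (B := 11 * O.unit g + (x.pow.natAbs + 2) * (24 * O.unit g) +
    (x.factors.length + 1) * (34 * O.unit g) + (x.factors.length + 6) * (5 * O.unit g))
    (by ring_nf; omega) ?_
  refine Spec.bind (B' := (x.pow.natAbs + 2) * (24 * O.unit g) +
    (x.factors.length + 1) * (34 * O.unit g) + (x.factors.length + 6) * (5 * O.unit g))
    (H.spec_leftCompl s) (by omega) fun s₁ hs₁ => ?_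
  refine Spec.bind (B' :=
    (x.factors.length + 1) * (34 * O.unit g) + (x.factors.length + 6) * (5 * O.unit g))
    (H.spec_tauPow x.pow s₁) (by omega) fun s' hs' => ?_
  refine Spec.bind (B' := (x.factors.length + 6) * (5 * O.unit g))
    (H.spec_insertLeft x.factors s') le_rfl ?_
  rintro ⟨y, ys⟩ h
  have hlen : ys.length = x.factors.length := by simpa using h.length_eq
  refine (H.spec_cleanUp (x.pow - 1) (h.isAlmostNormal hx (H.isSimple s'))).mono
    (by rw [hlen]) ?_
  rintro r ⟨hr₁, hr₂, hr₃⟩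
  refine ⟨hr₁, ?_, by simpa [hlen] using hr₃⟩
  rw [hr₂, h.prod_eq, hs', hs₁, NF.toGroup, zpow_sub_one,
    ← (Commute.inv_left (Commute.self_zpow g.delta x.pow)).eq]
  simp [mul_assoc]

/-- Each letter adds at most one factor, so k bounds the number of factors throughout. The exponent
does not enter, since right multiplication uses no powers of τ. -/
theorem spec_mulWord {k : ℕ} (w : List (Letter S)) {x : NF S} (hx : x.IsNormal g val)
    (hk : x.factors.length + w.length ≤ k) :
    Spec (mulWord O x w) ((w.length + 1) * ((k + 2) * (65 * O.unit g))) fun r =>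
      r.IsNormal g val ∧ r.toGroup g val = x.toGroup g val * wordVal val w := by
  have h₁ := H.one_le_unit
  have h₂ : 1 + (k + 2) * (64 * O.unit g) ≤ (k + 2) * (65 * O.unit g) := by ring_nf; nlinarith
  induction w generalizing x with
  | nil => exact Spec.tick_bind (B := 0) (by simp; omega) (Spec.pure ⟨hx, by simp [wordVal]⟩)
  | cons a w ih =>
    have e : ((a :: w).length + 1) * ((k + 2) * (65 * O.unit g)) =
      (w.length + 1) * ((k + 2) * (65 * O.unit g)) + (k + 2) * (65 * O.unit g) := by
      rw [List.length_cons]; ring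
    rw [List.length_cons] at hk
    have h₃ : (x.factors.length + 2) * (64 * O.unit g) ≤ (k + 2) * (64 * O.unit g) := by
      gcongr; omega
    have h₄ : (x.factors.length + 2) * (39 * O.unit g) ≤ (x.factors.length + 2) * (64 * O.unit g) := by
      gcongr; omega
    cases a with
    | pos s =>
      refine Spec.tick_bind (B := (w.length + 1) * ((k + 2) * (65 * O.unit g)) +
        (x.factors.length + 2) * (64 * O.unit g)) (by omega) ?_
      refine Spec.bind (B' := (w.length + 1) * ((k + 2) * (65 * O.unit g)))
        (H.spec_mulRight hx s) (by omega) ?_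
      rintro y ⟨hy₁, hy₂, hy₃⟩
      refine (ih hy₁ (by omega)).mono le_rfl fun r hr => ⟨hr.1, ?_⟩
      rw [hr.2, hy₂]
      simp [wordVal, Letter.toGroup, mul_assoc]
    | neg s =>
      refine Spec.tick_bind (B := (w.length + 1) * ((k + 2) * (65 * O.unit g)) +
        (x.factors.length + 2) * (64 * O.unit g)) (by omega) ?_
      refine Spec.bind (B' := (w.length + 1) * ((k + 2) * (65 * O.unit g)))
        (H.spec_mulRightInv hx s) (by omega) ?_
      rintro y ⟨hy₁, hy₂, hy₃⟩
      refine (ih hy₁ (by omega)).mono le_rfl fun r hr => ⟨hr.1, ?_⟩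
      rw [hr.2, hy₂]
      simp [wordVal, Letter.toGroup, mul_assoc]

theorem spec_normalForm {k : ℕ} (hk : 1 ≤ k) {w : List (Letter S)} (hw : w.length ≤ k) :
    Spec (normalForm O w) (391 * (k * (k * O.unit g))) fun r =>
      r.IsNormal g val ∧ r.toGroup g val = wordVal val w := by
  have h₁ := H.one_le_unit
  -- As k ≥ 1, the word length plus 1 is at most 2k, and k + 2 ≤ 3k; 390 = 2 · 3 · 65.
  have h₂ : (w.length + 1) * ((k + 2) * (65 * O.unit g)) ≤
      (2 * k) * ((3 * k) * (65 * O.unit g)) := by gcongr <;> omega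
  have h₃ : 1 ≤ k * (k * O.unit g) := Nat.mul_pos hk (Nat.mul_pos hk h₁)
  have h₄ : (2 * k) * ((3 * k) * (65 * O.unit g)) = 390 * (k * (k * O.unit g)) := by ring
  refine Spec.tick_bind (B := (w.length + 1) * ((k + 2) * (65 * O.unit g))) (by omega) ?_
  refine (H.spec_mulWord w (x := ⟨0, []⟩) isNormal_nil (by simpa using hw)).mono le_rfl ?_
  rintro r ⟨hr₁, hr₂⟩
  exact ⟨hr₁, by simpa [NF.toGroup] using hr₂⟩

theorem spec_factorsEq (l m : List S) :
    Spec (factorsEq O l m) ((l.length + 1) * (21 * O.unit g)) fun b =>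
      b = true ↔ l.map val = m.map val := by
  have h₁ := H.one_le_unit
  induction l generalizing m with
  | nil =>
    cases m with
    | nil => exact Spec.tick_bind (B := 0) (by simp; omega) (Spec.pure (by simp))
    | cons t m => exact Spec.tick_bind (B := 0) (by simp; omega) (Spec.pure (by simp))
  | cons s l ih =>
    have e : ((s :: l).length + 1) * (21 * O.unit g) =
      (l.length + 1) * (21 * O.unit g) + 21 * O.unit g := by rw [List.length_cons]; ring
    cases m with
    | nil => exact Spec.tick_bind (B := 0) (by omega) (Spec.pure (by simp))
    | cons t m =>
      refine Spec.tick_bind (B := (l.length + 1) * (21 * O.unit g) + 20 * O.unit g) (by omega) ?_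
      refine Spec.bind (B' := (l.length + 1) * (21 * O.unit g)) (H.spec_simpleEq s t)
        (by omega) fun b hb => ?_
      split_ifs with hb'
      · refine (ih m).mono le_rfl fun b' hb'' => ?_
        simp [hb'', hb.1 hb']
      · exact Spec.pure (by simp [← hb, hb'])

theorem spec_nfEq {x y : NF S} (hx : x.IsNormal g val) (hy : y.IsNormal g val) :
    Spec (nfEq O x y) ((x.factors.length + 2) * (21 * O.unit g)) fun b =>
      b = true ↔ x.toGroup g val = y.toGroup g val := by
  have := H.nontrivial
  have h₁ := H.one_le_unit
  have e : (x.factors.length + 2) * (21 * O.unit g) =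
    (x.factors.length + 1) * (21 * O.unit g) + 21 * O.unit g := by ring
  refine Spec.tick_bind (B := (x.factors.length + 1) * (21 * O.unit g)) (by omega) ?_
  split_ifs with hp
  · refine (H.spec_factorsEq x.factors y.factors).mono le_rfl fun b hb => ?_
    rw [hb]
    exact ⟨fun h => by rw [NF.toGroup, NF.toGroup, hp, h], fun h => (hx.eq_of_toGroup_eq hy h).2⟩
  · refine Spec.pure ?_
    simp only [Bool.false_eq_true, false_iff]
    exact fun h => hp (hx.eq_of_toGroup_eq hy h).1

theorem spec_prefixProg {x : NF S} (hx : x.IsNormal g val) :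
    Spec (prefixProg O x) ((x.pow.natAbs + x.factors.length + 4) * (24 * O.unit g)) fun r =>
      val r = g.prefPrefix (x.toGroup g val) := by
  have := H.nontrivial
  have h₁ := H.one_le_unit
  obtain ⟨p, l⟩ := x
  cases l with
  | nil =>
    -- With no factors the answer is 1, which is obtained as ∂(Δ).
    refine Spec.tick_bind (B := 11 * O.unit g) (by ring_nf; omega) ?_
    refine (H.spec_rightCompl O.delta).mono le_rfl fun r hr => ?_
    simp [hr, H.delta, NF.toGroup, prefPrefix_delta_zpow]
  | cons x₁ l =>
    have h₂ : l.length ≤ O.unit g * l.length := Nat.le_mul_of_pos_left _ h₁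
    refine Spec.tick_bind (B := (p.natAbs + 2) * (24 * O.unit g) + (l.length + 1) +
      35 * O.unit g) (by simp only [List.length_cons]; ring_nf; omega) ?_
    refine Spec.bind (B' := (l.length + 1) + 35 * O.unit g) (H.spec_tauPow (-p) x₁)
      (by simp; omega) fun i hi => ?_
    refine Spec.bind (B' := 35 * O.unit g) (spec_lastFactor x₁ l) (by omega) fun f hf => ?_
    refine Spec.bind (B' := 24 * O.unit g) (H.spec_rightCompl f) (by omega) fun f' hf' => ?_
    refine (H.spec_simpleGcd i f').mono le_rfl fun r hr => ?_
    have key := GarsideStructure.IsNormal.prefPrefix_eq (g := g) (x := val x₁)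
      (l := l.map val) hx p
    rw [hr, hi, hf', hf]
    simp only [NF.toGroup, List.map_cons] at key ⊢
    rw [key]
    congr 3
    simp only [← List.map_cons, List.getLast_map]

theorem spec_conjProg {x : NF S} (hx : x.IsNormal g val) (s : S) :
    Spec (conjProg O x s) ((x.pow.natAbs + 2 * x.factors.length + 8) * (39 * O.unit g)) fun r =>
      r.IsNormal g val ∧ r.toGroup g val = (val s)⁻¹ * x.toGroup g val * val s := by
  have h₁ := H.one_le_unit
  refine Spec.tick_bind (B := (x.pow.natAbs + x.factors.length + 4) * (39 * O.unit g) +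
    (x.factors.length + 1 + 2) * (39 * O.unit g)) (by ring_nf; omega) ?_
  refine Spec.bind (B' := (x.factors.length + 1 + 2) * (39 * O.unit g))
    (H.spec_mulLeftInv s hx) le_rfl ?_
  rintro y ⟨hy₁, hy₂, hy₃⟩
  refine (H.spec_mulRight hy₁ s).mono (by gcongr) ?_
  rintro r ⟨hr₁, hr₂, -⟩
  exact ⟨hr₁, by rw [hr₂, hy₂]⟩

end BasicOps.Models

/-! ### Digital search trees -/

namespace Tree

variable {K : Type} [DecidableEq K]

/-- The sequence is spelled by a path of the tree. -/
def Has : Tree K → List K → Prop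
  | _, [] => True
  | .empty, _ :: _ => False
  | .node k' c s, k :: ks => if k = k' then Has c ks else Has s (k :: ks)

/-- Siblings of the root carry distinct keys in `A`, and siblings of other nodes carry distinct
keys in `B`. -/
def Fits (B : Finset K) : Finset K → Tree K → Prop
  | _, .empty => True
  | A, .node k c s => k ∈ A ∧ Fits B B c ∧ Fits B (A.erase k) s

theorem has_nil (t : Tree K) : t.Has [] := by cases t <;> trivial

/-- A step to a sibling uses up one key of A. A step to a child uses up one letter of the sequence
and opens a fresh set of at most |B| siblings. -/
theorem spec_mem {A B : Finset K} {t : Tree K} (ht : t.Fits B A) (ks : List K) :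
    Spec (t.mem ks) (A.card + ks.length * (B.card + 1) + 1) fun b => b = true ↔ t.Has ks := by
  induction t generalizing A ks with
  | empty =>
    cases ks with
    | nil => exact Spec.tick_bind (B := 0) (by omega) (Spec.pure (by simp [Has]))
    | cons k ks => exact Spec.tick_bind (B := 0) (by omega) (Spec.pure (by simp [Has]))
  | node k' c s ihc ihs =>
    cases ks with
    | nil => exact Spec.tick_bind (B := 0) (by omega) (Spec.pure (by simp [Has]))
    | cons k ks =>
      have e : (k :: ks).length * (B.card + 1) = ks.length * (B.card + 1) + (B.card + 1) := by
        rw [List.length_cons]; ring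
      have hA : 1 ≤ A.card := Finset.card_pos.2 ⟨_, ht.1⟩
      refine Spec.tick_bind (B := A.card + (k :: ks).length * (B.card + 1)) (by omega) ?_
      by_cases h : k = k'
      · rw [if_pos h]
        refine (ihc ht.2.1 ks).mono (by omega) fun b hb => ?_
        rw [hb, Has, if_pos h]
      · rw [if_neg h]
        refine (ihs ht.2.2 (k :: ks)).mono ?_ fun b hb => ?_
        · rw [Finset.card_erase_of_mem ht.1]; omega
        · rw [hb, Has, if_neg h]

theorem spec_path {A B : Finset K} {ks : List K} (hA : ∀ k ∈ ks.head?, k ∈ A)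
    (hB : ∀ k ∈ ks.tail, k ∈ B) :
    Spec (path ks) (ks.length + 1) fun t => t.Fits B A ∧ ∀ ls, t.Has ls ↔ ls <+: ks := by
  induction ks generalizing A with
  | nil =>
    refine Spec.tick_bind (B := 0) (by simp) (Spec.pure ⟨trivial, fun ls => ?_⟩)
    cases ls <;> simp [Has]
  | cons k ks ih =>
    refine Spec.tick_bind (B := ks.length + 1) (by simp; omega) ?_
    refine Spec.bind (B' := 0)
      (ih (A := B) (fun l hl => hB l (List.mem_of_mem_head? hl))
        fun l hl => hB l (List.mem_of_mem_tail hl)) (by omega) ?_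
    rintro t ⟨ht, ht'⟩
    refine Spec.pure ⟨⟨hA k (by simp), ht, trivial⟩, fun ls => ?_⟩
    cases ls with
    | nil => simp [Has]
    | cons l ls =>
      by_cases h : l = k
      · simp [Has, h, ht', List.cons_prefix_cons]
      · simp [Has, h, List.cons_prefix_cons]

theorem spec_insert {A B : Finset K} {t : Tree K} (ht : t.Fits B A) {ks : List K}
    (hA : ∀ k ∈ ks.head?, k ∈ A) (hB : ∀ k ∈ ks.tail, k ∈ B) :
    Spec (t.insert ks) (A.card + ks.length * (B.card + 1) + 2) fun t' =>
      t'.Fits B A ∧ ∀ ls, t'.Has ls ↔ t.Has ls ∨ ls <+: ks := by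
  have hnil : ∀ (t : Tree K) ls, t.Has ls ↔ t.Has ls ∨ ls <+: [] := by
    intro t ls
    refine ⟨.inl, ?_⟩
    rintro (h | h)
    · exact h
    · rw [List.prefix_nil.1 h]; exact has_nil t
  induction t generalizing A ks with
  | empty =>
    cases ks with
    | nil => exact Spec.tick_bind (B := 0) (by omega) (Spec.pure ⟨ht, hnil _⟩)
    | cons k ks =>
      have e : (k :: ks).length ≤ (k :: ks).length * (B.card + 1) :=
        Nat.le_mul_of_pos_right _ (by omega)
      refine Spec.tick_bind (B := (k :: ks).length + 1) (by omega) ?_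
      refine (spec_path hA hB).mono le_rfl ?_
      rintro t ⟨ht, ht'⟩
      refine ⟨ht, fun ls => ?_⟩
      rw [ht']
      cases ls <;> simp [Has]
  | node k' c s ihc ihs =>
    cases ks with
    | nil => exact Spec.tick_bind (B := 0) (by omega) (Spec.pure ⟨ht, hnil _⟩)
    | cons k ks =>
      have e : (k :: ks).length * (B.card + 1) = ks.length * (B.card + 1) + (B.card + 1) := by
        rw [List.length_cons]; ring
      have hA' : 1 ≤ A.card := Finset.card_pos.2 ⟨_, ht.1⟩
      refine Spec.tick_bind (B := A.card + (k :: ks).length * (B.card + 1) + 1) (by omega) ?_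
      by_cases h : k = k'
      · rw [if_pos h]
        refine Spec.bind (B' := 0) (ihc ht.2.1 (fun l hl => hB l (List.mem_of_mem_head? hl))
          fun l hl => hB l (List.mem_of_mem_tail hl)) (by omega) ?_
        rintro t ⟨ht₁, ht₂⟩
        refine Spec.pure ⟨⟨ht.1, ht₁, ht.2.2⟩, fun ls => ?_⟩
        cases ls with
        | nil => simp [Has]
        | cons l ls =>
          by_cases h' : l = k'
          · simp [Has, h, h', ht₂, List.cons_prefix_cons]
          · simp [Has, h, h', List.cons_prefix_cons]
      · rw [if_neg h]
        refine Spec.bind (B' := 0) (ihs ht.2.2 (ks := k :: ks) ?_ hB) ?_ ?_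
        · intro l hl
          obtain rfl : k = l := by simpa using hl
          exact Finset.mem_erase.2 ⟨h, hA k (by simp)⟩
        · rw [Finset.card_erase_of_mem ht.1]; omega
        · rintro t ⟨ht₁, ht₂⟩
          refine Spec.pure ⟨⟨ht.1, ht.2.1, ht₁⟩, fun ls => ?_⟩
          cases ls with
          | nil => simp [Has]
          | cons l ls =>
            by_cases h' : l = k'
            · have : l ≠ k := fun h'' => h (h''.symm.trans h')
              simp [Has, h', List.cons_prefix_cons, Ne.symm h]
            · simp [Has, h', ht₂]

end Tree

/-! ### Spelling of normal forms -/

/-- The lexicographically first expression of `x` as a product of at most `n` atoms. -/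
noncomputable def lexWord (g : GarsideStructure G) (atom : Fin lam → G) :
    ℕ → G → List (Fin lam)
  | 0, _ => []
  | n + 1, x =>
    match firstAtom g atom x with
    | none => []
    | some i => i :: lexWord g atom n ((atom i)⁻¹ * x)

theorem length_lexWord_le (n : ℕ) (x : G) : (lexWord g atom n x).length ≤ n := by
  induction n generalizing x with
  | zero => simp [lexWord]
  | succ n ih =>
    rw [lexWord]
    split
    · simp
    · simpa using ih _

/-- The sequence that spells a list of simple elements. -/
noncomputable def factorsKey (g : GarsideStructure G) (atom : Fin lam → G) :
    List G → List (Sym lam)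
  | [] => [.final]
  | s :: l => (lexWord g atom (g.norm g.delta) s).reverse.map .atom ++
      .sep :: factorsKey g atom l

/-- The sequence that spells a normal form. -/
noncomputable def NF.key (g : GarsideStructure G) (atom : Fin lam → G) (val : S → G) (x : NF S) :
    List (Sym lam) :=
  .power x.pow :: factorsKey g atom (x.factors.map val)

theorem length_factorsKey_le (l : List G) :
    (factorsKey g atom l).length ≤ l.length * (g.norm g.delta + 1) + 1 := by
  induction l with
  | nil => simp [factorsKey]
  | cons s l ih =>
    have := length_lexWord_le (g := g) (atom := atom) (g.norm g.delta) s
    simp only [factorsKey, List.length_append, List.length_map, List.length_reverse,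
      List.length_cons, Nat.succ_mul]
    omega

theorem atoms_sep_prefix {u v : List (Fin lam)} {r r' : List (Sym lam)}
    (h : (u.map Sym.atom ++ .sep :: r) <+: (v.map Sym.atom ++ .sep :: r')) :
    u = v ∧ r <+: r' := by
  induction u generalizing v with
  | nil => cases v <;> simp_all [List.cons_prefix_cons]
  | cons i u ih =>
    cases v with
    | nil => simp [List.cons_prefix_cons] at h
    | cons j v =>
      simp only [List.map_cons, List.cons_append, List.cons_prefix_cons, Sym.atom.injEq] at h
      obtain ⟨rfl, h₂⟩ := ih h.2
      exact ⟨by rw [h.1], h₂⟩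

theorem not_final_prefix (u : List (Fin lam)) (r r' : List (Sym lam)) :
    ¬ (.final :: r) <+: (u.map Sym.atom ++ .sep :: r') := by
  cases u <;> simp [List.cons_prefix_cons]

theorem not_prefix_final (u : List (Fin lam)) (r r' : List (Sym lam)) :
    ¬ (u.map Sym.atom ++ .sep :: r') <+: (.final :: r) := by
  cases u <;> simp [List.cons_prefix_cons]

namespace BasicOps.Models

variable (H : O.Models g atom val)

include H

/-- Every atom taken lowers the norm, so `n` cannot run out before x becomes 1. -/
theorem prod_lexWord {n : ℕ} {x : G} (hx : x ∈ g.P) (hn : g.norm x ≤ n) :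
    ((lexWord g atom n x).map atom).prod = x := by
  induction n generalizing x with
  | zero =>
    by_contra h
    have := one_le_norm hx (fun h' => h (by simp [lexWord, h']))
    omega
  | succ n ih =>
    rw [lexWord]
    split
    · rename_i h
      by_contra hne
      obtain ⟨i, hi⟩ := H.exists_atom_le hx (fun h' => hne (by simp [h']))
      have := List.find?_eq_none.1 h i (by simp)
      simp [hi] at this
    · rename_i i h
      have hi : g.Le (atom i) x := by simpa using List.find?_some h
      have := H.norm_lt_of_le hi
      simp [ih hi (by omega)]

/-- Separators delimit the factors and the final mark the list, so the code is prefix-free; each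
factor is the product of its spelled atoms. -/
theorem factorsKey_prefix {l m : List G} (hl : ∀ t ∈ l, g.IsSimple t)
    (hm : ∀ t ∈ m, g.IsSimple t) (h : factorsKey g atom l <+: factorsKey g atom m) : l = m := by
  induction l generalizing m with
  | nil =>
    cases m with
    | nil => rfl
    | cons t m => exact absurd h (not_final_prefix _ _ _)
  | cons s l ih =>
    cases m with
    | nil => exact absurd h (not_prefix_final _ _ _)
    | cons t m =>
      obtain ⟨h₁, h₂⟩ := atoms_sep_prefix h
      have hs := hl s (by simp)
      have ht := hm t (by simp)
      have h₃ := H.prod_lexWord hs.mem hs.norm_le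
      rw [List.reverse_injective h₁, H.prod_lexWord ht.mem ht.norm_le] at h₃
      rw [h₃, ih (fun t ht => hl t (by simp [ht])) (fun t ht => hm t (by simp [ht])) h₂]

/-- The tree recognizes all prefixes of stored keys; prefix-freeness is what makes its positive
answers correct. -/
theorem key_prefix {x y : NF S} (h : x.key g atom val <+: y.key g atom val) :
    x.toGroup g val = y.toGroup g val := by
  obtain ⟨h₁, h₂⟩ := List.cons_prefix_cons.1 h
  have h₃ := H.factorsKey_prefix (H.isSimple_map _) (H.isSimple_map _) h₂
  rw [NF.toGroup, NF.toGroup, Sym.power.inj h₁, h₃]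

theorem key_eq {x y : NF S} (hx : x.IsNormal g val) (hy : y.IsNormal g val)
    (h : x.toGroup g val = y.toGroup g val) : x.key g atom val = y.key g atom val := by
  have := H.nontrivial
  obtain ⟨h₁, h₂⟩ := hx.eq_of_toGroup_eq hy h
  rw [NF.key, NF.key, h₁, h₂]

theorem spec_spellSimple (rest : List (Sym lam)) (s : S) :
    Spec (spellSimple O rest s) (8 * O.unit g) fun r =>
      r = (lexWord g atom (g.norm g.delta) (val s)).reverse.map .atom ++ .sep :: rest := by
  have h₂ := H.one_le_sweep
  -- The loop counter doubles as the length bound in `lexWord`, so both recursions take the same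
  -- atoms in step; it starts at ‖Δ‖.
  refine (Spec.loop (fun q n => g.norm (val q.2) ≤ n ∧
    (lexWord g atom n (val q.2)).reverse.map .atom ++ q.1 =
      (lexWord g atom (g.norm g.delta) (val s)).reverse.map .atom ++ .sep :: rest)
    (B := 4 * O.sweep) ?_ ⟨H.norm_le s, rfl⟩).mono (H.loop_le le_rfl 4) fun _ h => h
  rintro ⟨r, s⟩ n ⟨hn, heq⟩
  dsimp only at hn heq
  refine Spec.tick_bind (B := 3 * O.sweep) (by omega) ?_
  refine Spec.bind (B' := 0) (H.spec_takeLeft s) (by omega) ?_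
  rintro (_ | ⟨i, s'⟩) h
  · change val s = 1 at h
    refine Spec.pure ?_
    change r = _
    rw [← heq]
    have h₁ : lexWord g atom n (val s) = [] := by
      cases n with
      | zero => rfl
      | succ n =>
        have : firstAtom g atom (val s) = none := by
          refine List.find?_eq_none.2 fun i _ => ?_
          rw [h]
          simpa using fun hi => (H.isAtom i).2.1 (eq_one_of_le_one (H.isAtom i).1 hi)
        rw [lexWord, this]
    simp [h₁]
  · obtain ⟨hf, -, hi, hs'⟩ := h
    have := H.norm_lt_of_le hi
    obtain ⟨n, rfl⟩ : ∃ m, n = m + 1 := ⟨n - 1, by omega⟩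
    refine Spec.pure ⟨n, rfl, ?_, ?_⟩
    · dsimp only; rw [hs']; omega
    · rw [lexWord, hf] at heq
      simpa [hs'] using heq

theorem spec_spellFactors (l : List S) :
    Spec (spellFactors O l) ((l.length + 1) * (9 * O.unit g)) fun r =>
      r = factorsKey g atom (l.map val) := by
  have h₁ := H.one_le_unit
  induction l with
  | nil => exact Spec.tick_bind (B := 0) (by simp; omega) (Spec.pure rfl)
  | cons s l ih =>
    have e : ((s :: l).length + 1) * (9 * O.unit g) =
      (l.length + 1) * (9 * O.unit g) + 9 * O.unit g := by rw [List.length_cons]; ring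
    refine Spec.tick_bind (B := (l.length + 1) * (9 * O.unit g) + 8 * O.unit g) (by omega) ?_
    refine Spec.bind (B' := 8 * O.unit g) ih (by omega) ?_
    rintro r rfl
    exact H.spec_spellSimple _ s

theorem spec_spell (x : NF S) :
    Spec (spell O x) ((x.factors.length + 2) * (9 * O.unit g)) fun r =>
      r = x.key g atom val := by
  have h₁ := H.one_le_unit
  have e : (x.factors.length + 2) * (9 * O.unit g) =
    (x.factors.length + 1) * (9 * O.unit g) + 9 * O.unit g := by ring
  refine Spec.tick_bind (B := (x.factors.length + 1) * (9 * O.unit g)) (by omega) ?_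
  refine Spec.bind (B' := 0) (H.spec_spellFactors x.factors) (by omega) ?_
  rintro r rfl
  exact Spec.pure rfl

end BasicOps.Models

/-! ### Bounds along a trajectory -/

theorem GarsideStructure.mul_bounds {x y : G} {a b c d : ℤ}
    (hx : g.Le (g.delta ^ a) x ∧ g.Le x (g.delta ^ b))
    (hy : g.Le (g.delta ^ c) y ∧ g.Le y (g.delta ^ d)) :
    g.Le (g.delta ^ (a + c)) (x * y) ∧ g.Le (x * y) (g.delta ^ (b + d)) := by
  constructor
  · have := g.P.mul_mem ((conj_delta_zpow_mem_iff c _).2 hx.1) hy.1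
    simpa [Le, mul_assoc, zpow_add] using this
  · have := g.P.mul_mem hy.2 ((conj_delta_zpow_mem_iff d _).2 hx.2)
    rw [add_comm b d, (by rw [add_comm, zpow_add] : g.delta ^ (d + b) = g.delta ^ b * g.delta ^ d)]
    simpa [Le, mul_assoc] using this

theorem wordVal_bounds (hS : ∀ s, g.IsSimple (val s)) (w : List (Letter S)) :
    g.Le (g.delta ^ (-(w.length : ℤ))) (wordVal val w) ∧
      g.Le (wordVal val w) (g.delta ^ (w.length : ℤ)) := by
  induction w with
  | nil => simp [wordVal, Le, g.P.one_mem]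
  | cons a w ih =>
    have ha : g.Le (g.delta ^ (-1 : ℤ)) (a.toGroup val) ∧
        g.Le (a.toGroup val) (g.delta ^ (1 : ℤ)) := by
      cases a with
      | pos s =>
        refine ⟨?_, by simpa [Letter.toGroup] using (hS s).2⟩
        have := g.P.mul_mem g.delta_mem (hS s).mem
        simpa [Le, Letter.toGroup] using this
      | neg s =>
        constructor
        · simpa [Le, Letter.toGroup] using (hS s).leftCompl.mem
        · have := g.P.mul_mem (hS s).mem g.delta_mem
          simpa [Le, Letter.toGroup] using this
    have := mul_bounds ha ih
    have e : -((a :: w).length : ℤ) = -1 + -(w.length : ℤ) := by simp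
    have e' : ((a :: w).length : ℤ) = 1 + (w.length : ℤ) := by simp [add_comm]
    rw [e, e']
    simpa [wordVal] using this

/-- The element `y` is bounded by `Δ^{-k}` and `Δ^k`. -/
def Bounded (g : GarsideStructure G) (k : ℕ) (y : G) : Prop :=
  g.Le (g.delta ^ (-(k : ℤ))) y ∧ g.Le y (g.delta ^ (k : ℤ))

theorem wordVal_bounded (hS : ∀ s, g.IsSimple (val s)) {w : List (Letter S)} {k : ℕ}
    (hw : w.length ≤ k) : Bounded g k (wordVal val w) := by
  obtain ⟨h₁, h₂⟩ := wordVal_bounds hS w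
  exact ⟨(delta_zpow_le (by omega)).trans h₁, h₂.trans (delta_zpow_le (by omega))⟩

/-- The symbols after the first one in the spelling of a normal form. -/
def innerSyms (lam : ℕ) : Finset (Sym lam) :=
  insert .sep (insert .final (Finset.univ.image .atom))

/-- The first symbols in the spellings of the normal forms that are bounded by `Δ^{-k}`
and `Δ^k`. -/
noncomputable def powerSyms (lam k : ℕ) : Finset (Sym lam) := (Finset.Icc (-(k : ℤ)) k).image .power

theorem card_innerSyms_le : (innerSyms lam).card ≤ lam + 2 := by
  have h := Finset.card_image_le (s := (Finset.univ : Finset (Fin lam))) (f := Sym.atom)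
  rw [Finset.card_univ, Fintype.card_fin] at h
  have h₁ := Finset.card_insert_le (Sym.final : Sym lam) (Finset.univ.image .atom)
  have h₂ := Finset.card_insert_le (Sym.sep : Sym lam) (insert .final (Finset.univ.image .atom))
  rw [innerSyms]
  omega

theorem card_powerSyms_le (k : ℕ) : (powerSyms lam k).card ≤ 2 * k + 1 := by
  refine Finset.card_image_le.trans ?_
  rw [Int.card_Icc]
  omega

theorem mem_innerSyms_of_mem_factorsKey {l : List G} {a : Sym lam}
    (ha : a ∈ factorsKey g atom l) : a ∈ innerSyms lam := by
  induction l with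
  | nil => simp_all [factorsKey, innerSyms]
  | cons s l ih =>
    simp only [factorsKey, List.mem_append, List.mem_map, List.mem_cons] at ha
    rcases ha with ⟨i, -, rfl⟩ | rfl | ha
    · simp [innerSyms]
    · simp [innerSyms]
    · exact ih ha

namespace BasicOps.Models

variable (H : O.Models g atom val)

include H

theorem bounds {x : NF S} {k : ℕ} (hx : x.IsNormal g val) (hb : Bounded g k (x.toGroup g val)) :
    x.pow.natAbs ≤ k ∧ x.factors.length ≤ 2 * k := by
  have := H.nontrivial
  obtain ⟨h₁, h₂⟩ := GarsideStructure.IsNormal.bounds hx hb.1 hb.2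
  rw [List.length_map] at h₂
  omega

theorem slide_bounded {x : NF S} {k : ℕ} (hx : x.IsNormal g val)
    (hb : Bounded g k (x.toGroup g val)) : Bounded g k (g.slide (x.toGroup g val)) := by
  have := H.nontrivial
  exact GarsideStructure.IsNormal.slide_bounds hx rfl hb.1 hb.2

variable {k : ℕ} (hk : 1 ≤ k)

include hk

/-! ### Cost of single steps on elements between Δ^{-k} and Δ^k -/

theorem spec_prefixProg_of_bounded {x : NF S} (hx : x.IsNormal g val)
    (hb : Bounded g k (x.toGroup g val)) :
    Spec (prefixProg O x) (168 * (k * O.unit g)) fun r =>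
      val r = g.prefPrefix (x.toGroup g val) := by
  obtain ⟨h₁, h₂⟩ := H.bounds hx hb
  refine (H.spec_prefixProg hx).mono ?_ fun _ h => h
  -- 7k arises from |p| ≤ k, r ≤ 2k and 4 ≤ 4k; the bounds below arise in the same way.
  calc _ ≤ (7 * k) * (24 * O.unit g) := by gcongr; omega
    _ = _ := by ring

theorem spec_conjProg_of_bounded {x : NF S} (hx : x.IsNormal g val)
    (hb : Bounded g k (x.toGroup g val)) (s : S)
    (hs : val s = g.prefPrefix (x.toGroup g val)) :
    Spec (conjProg O x s) (507 * (k * O.unit g)) fun r =>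
      r.IsNormal g val ∧ r.toGroup g val = g.slide (x.toGroup g val) ∧
        Bounded g k (r.toGroup g val) := by
  obtain ⟨h₁, h₂⟩ := H.bounds hx hb
  refine (H.spec_conjProg hx s).mono ?_ fun r hr => ?_
  · calc _ ≤ (13 * k) * (39 * O.unit g) := by gcongr; omega
      _ = _ := by ring
  · have : r.toGroup g val = g.slide (x.toGroup g val) := by rw [hr.2, hs, slide]
    exact ⟨hr.1, this, this ▸ H.slide_bounded hx hb⟩

theorem spec_spell_of_bounded {x : NF S} (hx : x.IsNormal g val)
    (hb : Bounded g k (x.toGroup g val)) :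
    Spec (spell O x) (36 * (k * O.unit g)) fun r => r = x.key g atom val := by
  obtain ⟨h₁, h₂⟩ := H.bounds hx hb
  refine (H.spec_spell x).mono ?_ fun _ h => h
  calc _ ≤ (4 * k) * (9 * O.unit g) := by gcongr; omega
    _ = _ := by ring

theorem spec_nfEq_of_bounded {x y : NF S} (hx : x.IsNormal g val) (hy : y.IsNormal g val)
    (hb : Bounded g k (x.toGroup g val)) :
    Spec (nfEq O x y) (84 * (k * O.unit g)) fun b =>
      b = true ↔ x.toGroup g val = y.toGroup g val := by
  obtain ⟨h₁, h₂⟩ := H.bounds hx hb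
  refine (H.spec_nfEq hx hy).mono ?_ fun _ h => h
  calc _ ≤ (4 * k) * (21 * O.unit g) := by gcongr; omega
    _ = _ := by ring

/-- At most 2k + 1 exponents compete at the root, and at most λ + 2 symbols at every later node.
Spelling factors by atoms keeps this branching small, at the price of a key length O(k‖Δ‖). -/
theorem tree_cost_le {x : NF S} (hx : x.IsNormal g val) (hb : Bounded g k (x.toGroup g val)) :
    (powerSyms lam k).card + (x.key g atom val).length * ((innerSyms lam).card + 1) + 2 ≤
      29 * (k * O.unit g) := by
  obtain ⟨-, h₂⟩ := H.bounds hx hb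
  have hN := H.one_le_norm_delta
  have hlam := H.one_le_lam
  have hC := H.one_le_cost
  have h₃ := card_powerSyms_le (lam := lam) k
  have h₄ := card_innerSyms_le (lam := lam)
  have h₅ : k ≤ k * O.unit g := Nat.le_mul_of_pos_right _ H.one_le_unit
  have h₆ : (x.key g atom val).length ≤ 6 * (k * g.norm g.delta) := by
    have h₇ := length_factorsKey_le (g := g) (atom := atom) (x.factors.map val)
    rw [List.length_map] at h₇
    have h₈ : x.factors.length * (g.norm g.delta + 1) ≤ 2 * k * (g.norm g.delta + 1) := by gcongr
    have h₉ : k ≤ k * g.norm g.delta := Nat.le_mul_of_pos_right _ hN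
    rw [NF.key, List.length_cons]
    have : 2 * k * (g.norm g.delta + 1) = 2 * (k * g.norm g.delta) + 2 * k := by ring
    omega
  have h₁₀ : (x.key g atom val).length * ((innerSyms lam).card + 1) ≤ 24 * (k * O.unit g) := by
    calc _ ≤ (6 * (k * g.norm g.delta)) * (4 * lam) := by gcongr; omega
      _ = 24 * (k * (1 * lam * g.norm g.delta)) := by ring
      _ ≤ 24 * (k * O.unit g) := by unfold BasicOps.unit; gcongr
  omega

omit hk in
theorem key_mem_powerSyms {x : NF S} (hx : x.IsNormal g val)
    (hb : Bounded g k (x.toGroup g val)) :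
    (∀ a ∈ (x.key g atom val).head?, a ∈ powerSyms lam k) ∧
      ∀ a ∈ (x.key g atom val).tail, a ∈ innerSyms lam := by
  obtain ⟨h₁, -⟩ := H.bounds hx hb
  constructor
  · simp only [NF.key, List.head?_cons, Option.mem_def, Option.some.injEq, forall_eq', powerSyms,
      Finset.mem_image, Finset.mem_Icc, Sym.power.injEq, exists_eq_right]
    omega
  · exact fun a ha => mem_innerSyms_of_mem_factorsKey ha

/-- The main loop: if `j` is the index of the first repetition in the trajectory of `x`, then the
loop returns `𝔰^j(x)`. -/
theorem spec_trajectoryLoop {x : NF S} (hx : x.IsNormal g val)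
    (hb : Bounded g k (x.toGroup g val)) {j : ℕ}
    (hj : ∃ i < j, g.slide^[i] (x.toGroup g val) = g.slide^[j] (x.toGroup g val))
    (hmin : ∀ a b, a < b → b < j →
      g.slide^[a] (x.toGroup g val) ≠ g.slide^[b] (x.toGroup g val)) :
    Spec (trajectoryLoop O .empty [] x) ((j + 1) * (770 * (k * O.unit g))) fun r =>
      r.1.IsNormal g val ∧ Bounded g k (r.1.toGroup g val) ∧
      r.1.toGroup g val = g.slide^[j] (x.toGroup g val) ∧ r.2.length = j ∧
      ((r.2.reverse.map val).prod)⁻¹ * x.toGroup g val * (r.2.reverse.map val).prod =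
        r.1.toGroup g val := by
  have hU : 1 ≤ k * O.unit g := Nat.mul_pos hk H.one_le_unit
  -- The last clause says that the paths of the tree are exactly the prefixes of the keys of the
  -- iterates met so far; their number is the length of c. The constant is 770 = 1 + 36 + 29 + 29 +
  -- 168 + 507: clock, spelling, search, insertion, prefix, conjugation.
  refine Spec.loop (fun q n => q.1.Fits (innerSyms lam) (powerSyms lam k) ∧
    q.2.1.length + n = j ∧ q.2.2.IsNormal g val ∧ Bounded g k (q.2.2.toGroup g val) ∧
    q.2.2.toGroup g val = g.slide^[q.2.1.length] (x.toGroup g val) ∧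
    ((q.2.1.reverse.map val).prod)⁻¹ * x.toGroup g val * (q.2.1.reverse.map val).prod =
      q.2.2.toGroup g val ∧
    ∀ ks, q.1.Has ks ↔ ks = [] ∨ ∃ a < q.2.1.length, ∃ y : NF S, y.IsNormal g val ∧
      y.toGroup g val = g.slide^[a] (x.toGroup g val) ∧ ks <+: y.key g atom val) ?_
    ⟨trivial, by simp, hx, hb, by simp, by simp, fun ks => by cases ks <;> simp [Tree.Has]⟩
  rintro ⟨t, c, y⟩ n ⟨ht, hn, hy, hyb, hyv, hc, hmem⟩
  dsimp only at ht hn hy hyb hyv hc hmem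
  have hcost := H.tree_cost_le hk hy hyb
  refine Spec.tick_bind (B := 769 * (k * O.unit g)) (by omega) ?_
  refine Spec.bind (B' := 733 * (k * O.unit g)) (H.spec_spell_of_bounded hk hy hyb) (by omega) ?_
  rintro _ rfl
  refine Spec.bind (B' := 704 * (k * O.unit g)) (Tree.spec_mem ht _) (by omega) fun b hb' => ?_
  split_ifs with hbt
  · refine Spec.pure ?_
    have h₁ := (hmem _).1 (hb'.1 hbt)
    -- A hit is a genuine repetition, and by minimality of j none occurs earlier.
    have hcj : c.length = j := by
      rcases h₁ with h₁ | ⟨a, ha, z, hz, hzv, hpre⟩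
      · simp [NF.key] at h₁
      · have h₂ := H.key_prefix hpre
        rw [hyv, hzv] at h₂
        by_contra hne
        exact hmin a c.length ha (by omega) h₂.symm
    exact ⟨hy, hyb, by rw [hyv, hcj], hcj, hc⟩
  -- At index j the search succeeds: the iterate coincides with an earlier one, and equal elements
  -- have equal keys.
  · have hcj : c.length ≠ j := by
      rintro hcj
      refine hbt (hb'.2 ((hmem _).2 (.inr ?_)))
      obtain ⟨i, hi, hij⟩ := hj
      obtain ⟨z, hz, hzv⟩ : ∃ z : NF S, z.IsNormal g val ∧
          z.toGroup g val = g.slide^[i] (x.toGroup g val) :=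
        ⟨y, hy, by rw [hyv, hcj, hij]⟩
      refine ⟨i, by omega, z, hz, hzv, ?_⟩
      rw [H.key_eq hy hz (by rw [hyv, hzv, hcj, hij])]
    obtain ⟨m, rfl⟩ : ∃ m, n = m + 1 := ⟨n - 1, by omega⟩
    obtain ⟨hA, hB⟩ := H.key_mem_powerSyms hy hyb
    refine Spec.bind (B' := 675 * (k * O.unit g)) (Tree.spec_insert ht hA hB) (by omega) ?_
    rintro t' ⟨ht', hmem'⟩
    refine Spec.bind (B' := 507 * (k * O.unit g)) (H.spec_prefixProg_of_bounded hk hy hyb)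
      (by omega) fun s hs => ?_
    refine Spec.bind (B' := 0) (H.spec_conjProg_of_bounded hk hy hyb s hs) (by omega) ?_
    rintro y' ⟨hy', hyv', hyb'⟩
    refine Spec.pure ⟨m, rfl, ht', ?_, hy', hyb', ?_, ?_, ?_⟩
    · simp only [List.length_cons]; omega
    · simp only [List.length_cons, Function.iterate_succ_apply']
      rw [hyv', hyv]
    · dsimp only
      rw [hyv', slide, ← hc, List.reverse_cons, List.map_append, List.prod_append]
      simp only [List.map_cons, List.map_nil, List.prod_singleton]
      rw [hs, ← hc]
      simp only [mul_inv_rev, mul_assoc]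
    · intro ks
      dsimp only
      rw [hmem', hmem, or_assoc]
      refine or_congr_right ?_
      constructor
      · rintro (⟨a, ha, h⟩ | h)
        · exact ⟨a, by simp only [List.length_cons]; omega, h⟩
        · exact ⟨c.length, by simp, y, hy, hyv, h⟩
      · rintro ⟨a, ha, z, hz, hzv, hpre⟩
        rw [List.length_cons] at ha
        rcases Nat.lt_succ_iff_lt_or_eq.1 ha with ha | rfl
        · exact .inl ⟨a, ha, z, hz, hzv, hpre⟩
        · exact .inr (H.key_eq hz hy (by rw [hzv, hyv]) ▸ hpre)

/-- The second loop: if `𝔰^m(x) = x`, then the loop returns an element commuting with `x`. -/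
theorem spec_circuitLoop {x : NF S} (hx : x.IsNormal g val) {s : S}
    (hs : val s = g.prefPrefix (x.toGroup g val)) {y : NF S} (hy : y.IsNormal g val)
    (hyb : Bounded g k (y.toGroup g val)) (hyv : y.toGroup g val = g.slide (x.toGroup g val))
    {m : ℕ} (hm : g.slide^[m + 1] (x.toGroup g val) = x.toGroup g val) :
    Spec (circuitLoop O x [s] y) ((m + 1) * (760 * (k * O.unit g))) fun d =>
      d.length ≤ m + 1 ∧
      ((d.reverse.map val).prod)⁻¹ * x.toGroup g val * (d.reverse.map val).prod =
        x.toGroup g val := by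
  have hU : 1 ≤ k * O.unit g := Nat.mul_pos hk H.one_le_unit
  -- One slide is already recorded in d, so m further passes complete the circuit. The constant is
  -- 760 = 1 + 84 + 168 + 507: clock, comparison, prefix, conjugation.
  refine Spec.loop (fun q n =>
    q.1.length + n = m + 1 ∧ q.2.IsNormal g val ∧ Bounded g k (q.2.toGroup g val) ∧
    q.2.toGroup g val = g.slide^[q.1.length] (x.toGroup g val) ∧
    ((q.1.reverse.map val).prod)⁻¹ * x.toGroup g val * (q.1.reverse.map val).prod =
      q.2.toGroup g val) ?_
    ⟨by simp; omega, hy, hyb, by simpa using hyv, by simp [hyv, hs, slide]⟩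
  rintro ⟨d, y⟩ n ⟨hn, hy, hyb, hyv, hd⟩
  dsimp only at hn hy hyb hyv hd
  refine Spec.tick_bind (B := 759 * (k * O.unit g)) (by omega) ?_
  refine Spec.bind (B' := 675 * (k * O.unit g)) (H.spec_nfEq_of_bounded hk hy hx hyb)
    (by omega) fun b hb' => ?_
  split_ifs with hbt
  · exact Spec.pure ⟨by omega, by rw [hd, hb'.1 hbt]⟩
  · have hdm : d.length ≠ m + 1 := fun h => hbt (hb'.2 (by rw [hyv, h, hm]))
    obtain ⟨n, rfl⟩ : ∃ m, n = m + 1 := ⟨n - 1, by omega⟩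
    refine Spec.bind (B' := 507 * (k * O.unit g)) (H.spec_prefixProg_of_bounded hk hy hyb)
      (by omega) fun s hs => ?_
    refine Spec.bind (B' := 0) (H.spec_conjProg_of_bounded hk hy hyb s hs) (by omega) ?_
    rintro y' ⟨hy', hyv', hyb'⟩
    refine Spec.pure ⟨n, rfl, ?_, hy', hyb', ?_, ?_⟩
    · simp only [List.length_cons]; omega
    · simp only [List.length_cons, Function.iterate_succ_apply']
      rw [hyv', hyv]
    · dsimp only
      rw [hyv', slide, ← hd, List.reverse_cons, List.map_append, List.prod_append]
      simp only [List.map_cons, List.map_nil, List.prod_singleton]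
      rw [hs, ← hd]
      simp only [mul_inv_rev, mul_assoc]

/-- The verified procedures themselves supply the normal forms, so no separate existence proof is
needed. -/
theorem exists_iterate_slide {x : NF S} (hx : x.IsNormal g val)
    (hb : Bounded g k (x.toGroup g val)) (m : ℕ) : ∃ y : NF S, y.IsNormal g val ∧
      Bounded g k (y.toGroup g val) ∧ y.toGroup g val = g.slide^[m] (x.toGroup g val) := by
  induction m with
  | zero => exact ⟨x, hx, hb, rfl⟩
  | succ m ih =>
    obtain ⟨y, hy, hyb, hyv⟩ := ih
    obtain ⟨s, -, -, hs, -⟩ := H.spec_prefixProg_of_bounded hk hy hyb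
    obtain ⟨z, -, -, ⟨hz, hzv, hzb⟩, -⟩ := H.spec_conjProg_of_bounded hk hy hyb s hs
    exact ⟨z, hz, hzb, by rw [hzv, hyv, Function.iterate_succ_apply']⟩

/-- In a group of finite type, every trajectory is eventually periodic. -/
theorem exists_repetition (hfin : g.FiniteType) {x : NF S} (hx : x.IsNormal g val)
    (hb : Bounded g k (x.toGroup g val)) : ∃ i j, i < j ∧
      g.slide^[i] (x.toGroup g val) = g.slide^[j] (x.toGroup g val) := by
  have : Finite {s : G | g.IsSimple s} := hfin
  -- All iterates lie in this finite set, given by an exponent in [-k, k] and at most 2k simple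
  -- factors.
  have hF : (Set.image2 (fun (p : ℤ) (l : List {s : G | g.IsSimple s}) =>
      g.delta ^ p * (l.map Subtype.val).prod) (Set.Icc (-(k : ℤ)) k)
      {l | l.length ≤ 2 * k}).Finite :=
    (Set.finite_Icc _ _).image2 _ (List.finite_length_le _ _)
  refine hF.exists_lt_map_eq_of_forall_mem (f := fun m => g.slide^[m] (x.toGroup g val))
    fun m => ?_
  obtain ⟨y, hy, hyb, hyv⟩ := H.exists_iterate_slide hk hx hb m
  obtain ⟨h₁, h₂⟩ := H.bounds hy hyb
  refine ⟨y.pow, Set.mem_Icc.2 (by omega), y.factors.map fun s => ⟨val s, H.isSimple s⟩,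
    by simpa using h₂, ?_⟩
  dsimp only
  rw [← hyv, NF.toGroup, List.map_map]
  rfl

end BasicOps.Models

/-! ### Words for the conjugating element -/

theorem spec_invWord (l : List S) : Spec (invWord l) (l.length + 1) fun r =>
    wordVal val r = ((l.reverse.map val).prod)⁻¹ := by
  induction l with
  | nil => exact Spec.tick_bind (B := 0) (by simp) (Spec.pure (by simp [wordVal]))
  | cons s l ih =>
    refine Spec.tick_bind (B := l.length + 1) (by simp; omega) ?_
    refine Spec.bind (B' := 0) ih (by omega) fun r hr => Spec.pure ?_
    rw [List.reverse_cons, List.map_append, List.prod_append, mul_inv_rev, ← hr]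
    simp [wordVal, Letter.toGroup]

theorem spec_prependWord (l : List S) (w : List (Letter S)) :
    Spec (prependWord l w) (l.length + 1) fun r =>
      wordVal val r = (l.reverse.map val).prod * wordVal val w := by
  induction l generalizing w with
  | nil => exact Spec.tick_bind (B := 0) (by simp) (Spec.pure (by simp))
  | cons s l ih =>
    refine Spec.tick_bind (B := l.length + 1) (by simp; omega) ?_
    refine (ih _).mono le_rfl fun r hr => ?_
    rw [hr, List.reverse_cons, List.map_append, List.prod_append]
    simp [wordVal, Letter.toGroup, mul_assoc]

/-! ### The algorithm -/

/-- The bound is in terms of the exact index j of the first repetition; an arbitrary T enters only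
afterwards, by monotonicity. -/
theorem BasicOps.Models.spec_algorithm1 (H : O.Models g atom val) {k : ℕ} (hk : 1 ≤ k)
    {w : List (Letter S)} (hw : w.length ≤ k) {i j : ℕ} (hij : i < j)
    (hrep : g.slide^[i] (wordVal val w) = g.slide^[j] (wordVal val w))
    (hmin : ∀ a b, a < b → b < j → g.slide^[a] (wordVal val w) ≠ g.slide^[b] (wordVal val w)) :
    Spec (algorithm1 O w) (4000 * (k * (k + j) * O.unit g)) fun r =>
      r.1.toGroup g val = g.slide^[j] (wordVal val w) ∧
      (wordVal val r.2)⁻¹ * wordVal val w * wordVal val r.2 = r.1.toGroup g val := by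
  have hU : 1 ≤ k * O.unit g := Nat.mul_pos hk H.one_le_unit
  obtain ⟨m, rfl⟩ : ∃ m, j = i + (m + 1) := ⟨j - i - 1, by omega⟩
  set j := i + (m + 1) with hj
  have hcost : 1 + 391 * (k * (k * O.unit g)) + (j + 1) * (770 * (k * O.unit g)) +
      675 * (k * O.unit g) + (m + 1) * (760 * (k * O.unit g)) + (m + 2) + (j + 1) ≤
      4000 * (k * (k + j) * O.unit g) := by
    have e₁ : (m + 1) * (760 * (k * O.unit g)) ≤ (j + 1) * (760 * (k * O.unit g)) := by
      gcongr; omega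
    have e₂ : (j + 1) * 1 ≤ (j + 1) * (k * O.unit g) := by gcongr
    have e₃ : (j + 1) * (k * O.unit g) ≤ (k + j) * (k * O.unit g) :=
      Nat.mul_le_mul_right _ (by omega)
    have e₄ : k * (k * O.unit g) ≤ (k + j) * (k * O.unit g) :=
      Nat.mul_le_mul_right _ (by omega)
    have e₅ : k * O.unit g ≤ (k + j) * (k * O.unit g) := Nat.le_mul_of_pos_left _ (by omega)
    have e₆ : 4000 * (k * (k + j) * O.unit g) = 4000 * ((k + j) * (k * O.unit g)) := by ring
    have e₇ : (j + 1) * (770 * (k * O.unit g)) = 770 * ((j + 1) * (k * O.unit g)) := by ring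
    have e₈ : (j + 1) * (760 * (k * O.unit g)) = 760 * ((j + 1) * (k * O.unit g)) := by ring
    omega
  refine Spec.tick_bind (B := 391 * (k * (k * O.unit g)) + (j + 1) * (770 * (k * O.unit g)) +
    675 * (k * O.unit g) + (m + 1) * (760 * (k * O.unit g)) + (m + 2) + (j + 1)) (by omega) ?_
  refine Spec.bind (B' := (j + 1) * (770 * (k * O.unit g)) + 675 * (k * O.unit g) +
    (m + 1) * (760 * (k * O.unit g)) + (m + 2) + (j + 1)) (H.spec_normalForm hk hw) (by omega) ?_
  rintro x ⟨hx, hxv⟩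
  have hb : Bounded g k (x.toGroup g val) := hxv ▸ wordVal_bounded H.isSimple hw
  rw [← hxv] at hrep hmin ⊢
  refine Spec.bind (B' := 675 * (k * O.unit g) + (m + 1) * (760 * (k * O.unit g)) + (m + 2) +
    (j + 1)) (H.spec_trajectoryLoop hk hx hb ⟨i, hij, hrep⟩ hmin) (by omega) ?_
  rintro ⟨xt, c⟩ ⟨hxt, hxtb, hxtv, hcl, hc⟩
  dsimp only at hxt hxtb hxtv hcl hc
  refine Spec.bind (B' := 507 * (k * O.unit g) + (m + 1) * (760 * (k * O.unit g)) + (m + 2) +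
    (j + 1)) (H.spec_prefixProg_of_bounded hk hxt hxtb) (by omega) fun s hs => ?_
  refine Spec.bind (B' := (m + 1) * (760 * (k * O.unit g)) + (m + 2) + (j + 1))
    (H.spec_conjProg_of_bounded hk hxt hxtb s hs) (by omega) ?_
  rintro y ⟨hy, hyv, hyb⟩
  -- With m + 1 = j − i, sliding m + 1 times takes 𝔰^i(x) to 𝔰^j(x), and both are equal to x̃.
  have hm : g.slide^[m + 1] (xt.toGroup g val) = xt.toGroup g val := by
    rw [hxtv, ← hrep, ← Function.iterate_add_apply, add_comm, ← hj, hrep]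
  refine Spec.bind (B' := (m + 2) + (j + 1)) (H.spec_circuitLoop hk hxt hs hy hyb hyv hm)
    (by omega) ?_
  rintro d ⟨hdl, hd⟩
  refine Spec.bind (B' := j + 1) (spec_invWord (val := val) d) (by omega) fun w₁ hw₁ => ?_
  refine Spec.bind (B' := 0) (spec_prependWord (val := val) c w₁) (by omega) fun w₂ hw₂ => ?_
  refine Spec.pure ⟨hxtv, ?_⟩
  dsimp only
  rw [hw₂, hw₁]
  -- Conjugation by d fixes x̃, hence so does conjugation by d⁻¹, the extra factor of the returned
  -- word.
  have hd' : (d.reverse.map val).prod * xt.toGroup g val * ((d.reverse.map val).prod)⁻¹ =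
      xt.toGroup g val := by
    conv_lhs => rw [← hd]
    group
  conv_rhs => rw [← hd', ← hc]
  group

end Garside

theorem propositionP :
    ∃ K : ℕ, ∀ (G : Type*) [Group G] [Nontrivial G] (g : Garside.GarsideStructure G),
      g.FiniteType →
      ∀ (lam : ℕ) (atom : Fin lam → G), Function.Injective atom →
      Set.range atom = {a : G | g.IsAtom a} →
      ∀ (S : Type) (val : S → G) (O : Garside.BasicOps S lam),
      O.Realizes g atom val → 1 ≤ O.cost →
      ∀ (w : List (Garside.Letter S)) (x : G), x = Garside.wordVal val w →
      ∃ (xt : Garside.NF S) (c : List (Garside.Letter S)) (cost : ℕ),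
        ((xt, c), cost) ∈ (Garside.algorithm1 O w).run 0 ∧
        xt.toGroup g val ∈ g.SC x ∧
        (Garside.wordVal val c)⁻¹ * x * Garside.wordVal val c = xt.toGroup g val ∧
        (∃ i j : ℕ, i < j ∧ g.slide^[i] x = g.slide^[j] x ∧
          (∀ a b : ℕ, a < b → b < j → g.slide^[a] x ≠ g.slide^[b] x) ∧
          xt.toGroup g val = g.slide^[i] x) ∧
        ∀ k T : ℕ, 1 ≤ k → w.length ≤ k →
          (∃ i j : ℕ, i < j ∧ j ≤ T ∧ g.slide^[i] x = g.slide^[j] x) →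
          cost ≤ K * (O.cost * lam * k * (k + T) * g.norm g.delta) := by
  refine ⟨4000, fun G _ _ g hfin lam atom _ hatom S val O hO hcost w x hx => ?_⟩
  subst hx
  have H : O.Models g atom val :=
    { hO with
      range_atom := hatom
      one_le_cost := hcost
      delta_ne_one := Garside.GarsideStructure.delta_ne_one }
  obtain ⟨i₀, j₀, hij₀, hrep₀⟩ : ∃ i j, i < j ∧
      g.slide^[i] (Garside.wordVal val w) = g.slide^[j] (Garside.wordVal val w) := by
    -- The word may be empty, while the bounds require k ≥ 1; hence length plus one.
    obtain ⟨y, -, -, ⟨hy, hyv⟩, -⟩ := H.spec_normalForm (k := w.length + 1) (w := w)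
      (by omega) (by omega)
    rw [← hyv]
    refine H.exists_repetition (k := w.length + 1) (by omega) hfin hy ?_
    rw [hyv]
    exact Garside.wordVal_bounded H.isSimple (by omega)
  classical
  have hex : ∃ j i, i < j ∧
      g.slide^[i] (Garside.wordVal val w) = g.slide^[j] (Garside.wordVal val w) :=
    ⟨j₀, i₀, hij₀, hrep₀⟩
  -- The least j that repeats an earlier index; it is at most any T admitted in the cost bound.
  obtain ⟨i, hij, hrep⟩ := Nat.find_spec hex
  have hfirst : ∀ a b, a < b →
      g.slide^[a] (Garside.wordVal val w) = g.slide^[b] (Garside.wordVal val w) →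
      Nat.find hex ≤ b := fun a b hab h => Nat.find_min' hex ⟨a, hab, h⟩
  generalize Nat.find hex = j at hij hrep hfirst
  have hmin : ∀ a b, a < b → b < j →
      g.slide^[a] (Garside.wordVal val w) ≠ g.slide^[b] (Garside.wordVal val w) :=
    fun a b hab hbj h => absurd (hfirst a b hab h) (by omega)
  -- The run and its cost are fixed before k and T are given, so the smallest admissible k is used
  -- here.
  obtain ⟨⟨xt, c⟩, cost, hle, ⟨hxt, hc⟩, hrun⟩ := H.spec_algorithm1 (k := max 1 w.length)
    (le_max_left _ _) (le_max_right _ _) hij hrep hmin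
  refine ⟨xt, c, cost, by simpa [StateT.run] using hrun 0, ⟨?_, ?_⟩, hc, ⟨i, j, hij, hrep, hmin, ?_⟩, ?_⟩
  · rw [isConj_iff]
    exact ⟨(Garside.wordVal val c)⁻¹, by rw [← hc, inv_inv]⟩
  · refine ⟨j - i, by omega, ?_⟩
    rw [hxt, ← hrep, ← Function.iterate_add_apply, Nat.sub_add_cancel hij.le, hrep]
  · rw [hrep]; exact hxt
  · rintro k T hk hwk ⟨a, b, hab, hbT, h⟩
    have hjT : j ≤ T := (hfirst a b hab h).trans hbT
    have hkk : max 1 w.length ≤ k := max_le hk hwk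
    calc cost ≤ 4000 * (max 1 w.length * (max 1 w.length + j) * O.unit g) := hle
      _ ≤ 4000 * (k * (k + T) * O.unit g) := by gcongr
      _ = 4000 * (O.cost * lam * k * (k + T) * g.norm g.delta) := by
        unfold Garside.BasicOps.unit; ring
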